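/- Let $n\ge 1$ be an integer. A centrally symmetric convex body in $\mathbb{R}^n$ is a compact convex set $K\subset\mathbb{R}^n$ with non-empty interior that is symmetric about some point, its center. For such a $K$ let $\mathcal{K}$ be the family of all sets $v+rK$ with $v\in\mathbb{R}^n$ and $r>0$; for $S\in\mathcal{K}$ and $\lambda\in(0,1]$ let $\lambda S$ be the image of $S$ under the homothety with ratio $\lambda$ about the center of $S$. For a nonnegative locally integrable function $f$ on $\mathbb{R}^n$ put $$M_\lambda f(x)=\sup_{S\in\mathcal{K}:\ x\in\lambda S}\ \frac{1}{|S|}\int_S f\in[0,\infty].$$ Let $B(n)$ denote the Besicovitch constant of $\mathbb{R}^n$, that is, the least positive integer $N$ with the following property: for every centrally symmetric convex body $K\subset\mathbb{R}^n$ and every subfamily $\mathcal{F}\subset\mathcal{K}$ whose set of centers is bounded and whose members have bounded diameters, there is an at most countable $\mathcal{G}\subset\mathcal{F}$ whose union contains the centers of all members of $\mathcal{F}$ and such that every point of $\mathbb{R}^n$ lies in at most $N$ members of $\mathcal{G}$. Theorem. Let $n\ge 1$ and $p\in(1,\infty)$. (1) For every $\lambda\in(0,1]$ there is a constant $A=A(n,p,\lambda)>1$,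 depending only on $n$, $p$ and $\lambda$, such that for every centrally symmetric convex body $K\subset\mathbb{R}^n$ and every nonnegative $f\in L^p(\mathbb{R}^n)$ $$\|M_\lambda f\|_{L^p}\ge A\,\|f\|_{L^p}.$$ (2) The number $B(n)$ exists, and for $\lambda=1$ one can take $A=\Bigl(1+\frac{1}{(p-1)B(n)}\Bigr)^{1/p}$ in (1). -/

import Mathlib

open MeasureTheory Set
open scoped ENNReal Pointwise

noncomputable section

/-- `c` is a center of symmetry of the set `S`.  A nonempty bounded set has at most one. -/
def IsCenter {n : ℕ} (S : Set (EuclideanSpace ℝ (Fin n))) (c : EuclideanSpace ℝ (Fin n)) : Prop :=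
  ∀ x ∈ S, c + (c - x) ∈ S

/-- A centrally symmetric convex body: a compact convex set with nonempty interior that is
symmetric about some point (not necessarily the origin). -/
def IsSymmetricBody {n : ℕ} (K : ConvexBody (EuclideanSpace ℝ (Fin n))) : Prop :=
  (interior (K : Set (EuclideanSpace ℝ (Fin n)))).Nonempty ∧
    ∃ c, IsCenter (K : Set (EuclideanSpace ℝ (Fin n))) c

/-- The family of all shifts of (nondegenerate) dilations of `K`. -/
def homothets {n : ℕ} (K : ConvexBody (EuclideanSpace ℝ (Fin n))) :
    Set (Set (EuclideanSpace ℝ (Fin n))) :=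
  {S | ∃ (v : EuclideanSpace ℝ (Fin n)) (r : ℝ), 0 < r ∧
    S = v +ᵥ r • (K : Set (EuclideanSpace ℝ (Fin n)))}

/-- The maximal function `M_l f` at `x`: the supremum of the averages of `f` over those shifts and
dilates `S` of `K` for which `x` lies in the image of `S` under the homothety with ratio `l` about
the center of `S`.  It takes values in `[0, ∞]`; `f` is meant to be nonnegative. -/
def maximalFn {n : ℕ} (K : ConvexBody (EuclideanSpace ℝ (Fin n))) (l : ℝ)
    (f : EuclideanSpace ℝ (Fin n) → ℝ) (x : EuclideanSpace ℝ (Fin n)) : ℝ≥0∞ :=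
  ⨆ (S : Set (EuclideanSpace ℝ (Fin n))) (_ : S ∈ homothets K)
    (_ : ∃ c, IsCenter S c ∧ x ∈ AffineMap.homothety c l '' S),
    (∫⁻ y in S, ENNReal.ofReal (f y)) / volume S

/-- `N` is an admissible overlap number in the Besicovitch covering property for all centrally
symmetric convex bodies `K` of `ℝⁿ`: for every family `F` of shifts and dilates of `K` with bounded
set of centers and bounded diameters, some at most countable subfamily `G` covers all the centers
and covers no point more than `N` times. -/
def BesicovitchBound (n N : ℕ) : Prop :=
  ∀ K : ConvexBody (EuclideanSpace ℝ (Fin n)), IsSymmetricBody K →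
    ∀ F : Set (Set (EuclideanSpace ℝ (Fin n))), F ⊆ homothets K →
      Bornology.IsBounded {c | ∃ S ∈ F, IsCenter S c} →
      (∃ D : ℝ, ∀ S ∈ F, Metric.diam S ≤ D) →
      ∃ G : Set (Set (EuclideanSpace ℝ (Fin n))), G ⊆ F ∧ G.Countable ∧
        {c | ∃ S ∈ F, IsCenter S c} ⊆ ⋃₀ G ∧
        ∀ x, {S | S ∈ G ∧ x ∈ S}.encard ≤ N

/-- The Besicovitch constant `B(n)`: the least admissible overlap number. -/
def besicovitchConst (n : ℕ) : ℕ := sInf {N | BesicovitchBound n N}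

end

/-!
The proof replaces the body `K` by its norm `q`, so that the sets `v + r K` become the balls of `q`,
and works with the maximal function `ballMaximal` of `[0, ∞]`-valued functions on an arbitrary
finite-dimensional space with a Haar measure.

**The Besicovitch constant.** Mathlib's Besicovitch covering theorem, applied to the space normed
by `q`, gives `5 ^ n` families of disjoint balls, whatever `q` is. Hence the set of admissible
overlap numbers is nonempty, and `B(n)` is a minimum.

**Uncentered case.** Fix a level `t > 0`. Almost every point of `{f > t}` is the center of a ball
over which `f` has average exactly `t`, namely the largest one with average at least `t`. On such a
ball the integral of `(f - t)₊` equals that of `(t - f)₊`, hence is at most `t` times the measure of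
the part of the ball where `f ≤ t`. The balls lie in `{M f ≥ t}`; selecting a subfamily with overlap
at most `N` and summing gives `∫_{f > t} (f - t) ≤ N t |{M f ≥ t} \ {f > t}|`
(`OverlapBound.setLIntegral_add_le`). Integration against `p t ^ (p - 2) dt` yields
`(1 + 1 / ((p - 1) N)) ∫ f ^ p ≤ ∫ (M f) ^ p` (`OverlapBound.ofReal_mul_lintegral_rpow_le`).

**Almost centered case.** Let `M` be the maximal function with parameter `l` and `M₁` the uncentered
one. A fixed number `k` of iterations of `M` recovers `M₁` up to a factor `1 - ε`
(`IsBodyNorm.mul_ballMaximal_one_le_iterate`). Indeed, if `f` has average `a` over a ball, then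
`M f ≥ a` on the ball shrunk by `l`, and it is enough that the iterates of the indicator function of
the small ball be at least `1 - ε` on the large one. By Auerbach's lemma there is a quadratic form
`Q` comparable to `q ^ 2` with constants depending on the dimension only. Averages of `Q` over balls
exceed the value at the center by a term quadratic in the radius, while moving the center inwards
gains a term linear in the radius; so each iteration raises a lower bound of the form
`1 - (Q + b) / W` by a fixed amount (`IsBodyNorm.one_le_iterate_add`).

With `ε` small, the uncentered case gives `‖M^k f‖ ≥ β ‖f‖` with `β > 1`. On the other hand, by
sublinearity and the Hardy-Littlewood maximal theorem, `‖M^k f‖ ≤ ‖f‖ + D ‖M f - f‖`. Hence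
`‖M f - f‖` is at least a fixed multiple of `‖f‖`, and
`∫ (M f) ^ p ≥ ∫ f ^ p + ∫ (M f - f) ^ p` concludes
(`exists_ofReal_mul_lintegral_rpow_le`).
-/

open Filter Topology Module

set_option linter.unusedSectionVars false

/-! ### Norms of symmetric convex bodies and the Besicovitch covering theorem -/

/-- `q` is the norm of a centrally symmetric convex body: its closed unit ball is compact and has
nonempty interior (the latter follows from continuity). -/
structure IsBodyNorm {E : Type*} [NormedAddCommGroup E] [NormedSpace ℝ E] (q : Seminorm ℝ E) :
    Prop where
  continuous : Continuous q
  isCompact_unitBall : IsCompact (q.closedBall 0 1)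

section BodyNorm

variable {E : Type*} [NormedAddCommGroup E] [NormedSpace ℝ E] {q : Seminorm ℝ E}

/-- The gauge of `K - c` is the norm with unit ball `K - c`. -/
lemma exists_isBodyNorm {K : Set E} {c : E} (hconv : Convex ℝ K) (hcomp : IsCompact K)
    (hint : (interior K).Nonempty) (hc : ∀ x ∈ K, c + (c - x) ∈ K) :
    ∃ q : Seminorm ℝ E, IsBodyNorm q ∧ K = q.closedBall c 1 := by
  set K₀ : Set E := (fun x ↦ c + x) ⁻¹' K with hK₀
  have hsymm : ∀ x ∈ K₀, -x ∈ K₀ := by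
    intro x hx
    have := hc _ hx
    simp only [hK₀, mem_preimage]
    rwa [sub_add_cancel_left] at this
  have hconv₀ : Convex ℝ K₀ := hconv.translate_preimage_right c
  have hclosed : IsClosed K₀ := hcomp.isClosed.preimage (by fun_prop)
  have hnhds : K₀ ∈ 𝓝 (0 : E) := by
    obtain ⟨x, hx⟩ := hint
    have h1 : c ∈ interior K := by
      have := hconv.combo_interior_self_mem_interior hx (hc x (interior_subset hx))
        (a := 1 / 2) (b := 1 / 2) (by norm_num) (by norm_num) (by norm_num)
      convert this using 1
      rw [← smul_add]
      have h2 : x + (c + (c - x)) = (2 : ℝ) • c := by rw [two_smul]; abel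
      rw [h2, smul_smul]; norm_num
    have h2 : K ∈ 𝓝 (c + 0) := by rw [add_zero]; exact mem_interior_iff_mem_nhds.1 h1
    have hcont : Continuous fun x : E ↦ c + x := by fun_prop
    exact hcont.continuousAt.preimage_mem_nhds h2
  have hbal : Balanced ℝ K₀ := by
    rintro a ha _ ⟨x, hx, rfl⟩
    rw [Real.norm_eq_abs, abs_le] at ha
    have := hconv₀ hx (hsymm x hx) (a := (1 + a) / 2) (b := (1 - a) / 2) (by linarith)
      (by linarith) (by ring)
    convert this using 1
    simp only [smul_neg, ← sub_eq_add_neg, ← sub_smul]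
    congr 1; ring
  have habs : Absorbent ℝ K₀ := absorbent_nhds_zero hnhds
  have hball : (gaugeSeminorm hbal hconv₀ habs).closedBall 0 1 = K₀ := by
    ext x
    rw [Seminorm.mem_closedBall_zero]
    change gauge K₀ x ≤ 1 ↔ _
    rw [gauge_le_one_iff_mem_closure hconv₀ hnhds, hclosed.closure_eq]
  refine ⟨gaugeSeminorm hbal hconv₀ habs, ⟨continuous_gauge hconv₀ hnhds, ?_⟩, ?_⟩
  · rw [hball]
    have : K₀ = (Homeomorph.addLeft c) ⁻¹' K := rfl
    rw [this]
    exact (Homeomorph.isCompact_preimage _).2 hcomp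
  · ext x
    have : x ∈ K ↔ x - c ∈ K₀ := by simp [hK₀]
    have h2 : x - c ∈ (gaugeSeminorm hbal hconv₀ habs).closedBall 0 1 ↔ x - c ∈ K₀ := by
      rw [hball]
    rw [this, ← h2, Seminorm.mem_closedBall_zero, Seminorm.mem_closedBall]

lemma Seminorm.closedBall_eq_vadd_smul (q : Seminorm ℝ E) (z : E) {r : ℝ} (hr : 0 < r) :
    q.closedBall z r = z +ᵥ r • q.closedBall 0 1 := by
  rw [Seminorm.smul_closedBall_zero (by simpa using hr.ne'), Seminorm.vadd_closedBall]
  simp [abs_of_pos hr]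

namespace IsBodyNorm

lemma eq_zero (hq : IsBodyNorm q) {x : E} (hx : q x = 0) : x = 0 := by
  by_contra hne
  obtain ⟨R, hR⟩ := hq.isCompact_unitBall.isBounded.exists_norm_le
  have := hR (((|R| + 1) / ‖x‖) • x) (by
    rw [Seminorm.mem_closedBall_zero, map_smul_eq_mul, hx]; simp)
  rw [norm_smul, norm_div, norm_norm, div_mul_cancel₀ _ (norm_ne_zero_iff.2 hne),
    Real.norm_eq_abs] at this
  have h2 := le_abs_self (|R| + 1)
  have h3 := le_abs_self R
  linarith

lemma isCompact (hq : IsBodyNorm q) (z : E) {r : ℝ} (hr : 0 < r) :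
    IsCompact (q.closedBall z r) := by
  rw [q.closedBall_eq_vadd_smul z hr]
  exact (hq.isCompact_unitBall.smul r).vadd z

lemma isClosed (hq : IsBodyNorm q) (z : E) (r : ℝ) : IsClosed (q.closedBall z r) := by
  have : q.closedBall z r = {y | q (y - z) ≤ r} := by ext; simp
  rw [this]
  exact isClosed_le (hq.continuous.comp (by fun_prop)) continuous_const

lemma isOpen_ball (hq : IsBodyNorm q) (z : E) (r : ℝ) : IsOpen (q.ball z r) := by
  have : q.ball z r = {y | q (y - z) < r} := by ext; simp
  rw [this]
  exact isOpen_lt (hq.continuous.comp (by fun_prop)) continuous_const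

end IsBodyNorm

/-- A ball with nonnegative radius has only one center of symmetry: a second center `c` would make
the ball invariant under a translation. -/
lemma IsBodyNorm.center_unique (hq : IsBodyNorm q) {z c : E} {r : ℝ} (hr : 0 ≤ r)
    (hc : ∀ x ∈ q.closedBall z r, c + (c - x) ∈ q.closedBall z r) : c = z := by
  by_contra hne
  have hpos : 0 < q (c - z) := by
    refine lt_of_le_of_ne (apply_nonneg _ _) fun h ↦ hne ?_
    exact sub_eq_zero.1 (hq.eq_zero h.symm)
  -- reflect in `c` the boundary point of the ball opposite to `c`
  have h1 := hc (z - (r / q (c - z)) • (c - z)) (by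
    rw [Seminorm.mem_closedBall, sub_sub_cancel_left, map_neg_eq_map, map_smul_eq_mul, norm_div,
      Real.norm_eq_abs, Real.norm_eq_abs, abs_of_nonneg hr, abs_of_pos hpos,
      div_mul_cancel₀ _ hpos.ne'])
  have h2 : c + (c - (z - (r / q (c - z)) • (c - z))) - z
      = (2 + r / q (c - z)) • (c - z) := by
    rw [add_smul, two_smul]; abel
  rw [Seminorm.mem_closedBall, h2, map_smul_eq_mul, Real.norm_eq_abs,
    abs_of_pos (by positivity), add_mul, div_mul_cancel₀ _ hpos.ne'] at h1
  linarith

lemma center_closedBall (q : Seminorm ℝ E) (z : E) (r : ℝ) :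
    ∀ x ∈ q.closedBall z r, z + (z - x) ∈ q.closedBall z r := by
  intro x hx
  rw [Seminorm.mem_closedBall] at hx ⊢
  rw [add_sub_cancel_left, ← map_neg_eq_map, neg_sub]
  exact hx

lemma homothety_image_closedBall (q : Seminorm ℝ E) (z : E) (r : ℝ) {l : ℝ} (hl : 0 < l) :
    AffineMap.homothety z l '' q.closedBall z r = q.closedBall z (l * r) := by
  ext y
  simp only [mem_image, Seminorm.mem_closedBall, AffineMap.homothety_apply, vsub_eq_sub,
    vadd_eq_add]
  constructor
  · rintro ⟨x, hx, rfl⟩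
    rw [add_sub_cancel_right, map_smul_eq_mul, Real.norm_eq_abs, abs_of_pos hl]
    gcongr
  · intro hy
    refine ⟨z + l⁻¹ • (y - z), ?_, ?_⟩
    · rw [add_sub_cancel_left, map_smul_eq_mul, Real.norm_eq_abs, abs_of_pos (inv_pos.2 hl),
        inv_mul_le_iff₀ hl]
      exact hy
    · rw [add_sub_cancel_left, smul_smul, mul_inv_cancel₀ hl.ne', one_smul, sub_add_cancel]

end BodyNorm

/-- Besicovitch's covering theorem for the balls of an arbitrary norm on a finite-dimensional
space, with a number of disjoint families bounded in terms of the dimension only. -/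
lemma exists_disjoint_covering_families {V ι : Type*} [AddCommGroup V] [Module ℝ V]
    [FiniteDimensional ℝ V] (q : Seminorm ℝ V) (hq : ∀ x, q x = 0 → x = 0) (c : ι → V)
    (r : ι → ℝ) (hr : ∀ i, 0 < r i) (R : ℝ) (hR : ∀ i, r i ≤ R) :
    ∃ s : Fin (5 ^ finrank ℝ V) → Set ι,
      (∀ i, (s i).PairwiseDisjoint fun j ↦ q.closedBall (c j) (r j)) ∧
      (∀ i, (s i).Countable) ∧ ∀ j, ∃ i, ∃ k ∈ s i, c j ∈ q.closedBall (c k) (r k) := by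
  let : Norm V := ⟨q⟩
  have core : NormedSpace.Core ℝ V :=
    { norm_nonneg := fun x ↦ apply_nonneg q x
      norm_smul := fun a x ↦ map_smul_eq_mul q a x
      norm_triangle := fun x y ↦ map_add_le_add q x y
      norm_eq_zero_iff := fun x ↦ ⟨hq x, fun h ↦ by rw [h]; exact map_zero q⟩ }
  let : NormedAddCommGroup V := NormedAddCommGroup.ofCore core
  let : NormedSpace ℝ V := NormedSpace.ofCore core
  have hball : ∀ x s, q.closedBall x s = Metric.closedBall x s := by
    intro x s
    ext y
    rw [Seminorm.mem_closedBall, Metric.mem_closedBall, dist_eq_norm]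
    rfl
  obtain ⟨s, hs, hcov⟩ := Besicovitch.exist_disjoint_covering_families
    (Besicovitch.one_lt_goodτ V) (Besicovitch.isEmpty_satelliteConfig_multiplicity V)
    ⟨c, r, hr, R, hR⟩
  have hcount : ∀ i, (s i).Countable := fun i ↦ by
    have := FiniteDimensional.proper_real V
    refine (hs i).countable_of_nonempty_interior fun j _ ↦ ⟨c j, ?_⟩
    exact Metric.ball_subset_interior_closedBall (Metric.mem_ball_self (hr j))
  have hle : Besicovitch.multiplicity V ≤ 5 ^ finrank ℝ V := Besicovitch.multiplicity_le
  refine ⟨fun i ↦ if h : (i : ℕ) < Besicovitch.multiplicity V then s ⟨i, h⟩ else ∅, ?_, ?_, ?_⟩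
  · intro i
    dsimp only
    split_ifs with h
    · simpa only [hball] using hs ⟨i, h⟩
    · exact pairwiseDisjoint_empty
  · intro i
    dsimp only
    split_ifs with h
    · exact hcount _
    · exact countable_empty
  · intro j
    have := hcov (mem_range_self j)
    simp only [mem_iUnion] at this
    obtain ⟨i, k, hk, hj⟩ := this
    refine ⟨⟨i, i.2.trans_le hle⟩, k, ?_, ?_⟩
    · simpa using hk
    · rw [hball]; exact Metric.ball_subset_closedBall hj

/-! ### The maximal function and Lebesgue differentiation -/

section Measure

variable {E : Type*} [NormedAddCommGroup E] [NormedSpace ℝ E] {q : Seminorm ℝ E}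
  [MeasurableSpace E] {μ : Measure E}

/-- The maximal function with respect to the balls of `q`: the supremum of the averages of `f` over
those balls whose concentric dilate by the factor `l` contains the given point. -/
noncomputable def ballMaximal (q : Seminorm ℝ E) (μ : Measure E) (l : ℝ) (f : E → ℝ≥0∞) (x : E) :
    ℝ≥0∞ :=
  ⨆ (z : E) (r : ℝ) (_ : 0 < r) (_ : x ∈ q.closedBall z (l * r)),
    (∫⁻ y in q.closedBall z r, f y ∂μ) / μ (q.closedBall z r)

lemma le_ballMaximal {l : ℝ} {f : E → ℝ≥0∞} {x z : E} {r : ℝ} (hr : 0 < r)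
    (hx : x ∈ q.closedBall z (l * r)) :
    (∫⁻ y in q.closedBall z r, f y ∂μ) / μ (q.closedBall z r) ≤ ballMaximal q μ l f x :=
  le_iSup_of_le z <| le_iSup_of_le r <| le_iSup_of_le hr <| le_iSup_of_le hx le_rfl

lemma lt_ballMaximal_iff {l : ℝ} {f : E → ℝ≥0∞} {x : E} {t : ℝ≥0∞} :
    t < ballMaximal q μ l f x ↔ ∃ z r, 0 < r ∧ x ∈ q.closedBall z (l * r) ∧
      t < (∫⁻ y in q.closedBall z r, f y ∂μ) / μ (q.closedBall z r) := by
  simp only [ballMaximal, lt_iSup_iff, exists_prop]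

lemma ballMaximal_mono {l : ℝ} {f g : E → ℝ≥0∞} (h : f ≤ g) :
    ballMaximal q μ l f ≤ ballMaximal q μ l g := by
  intro x
  refine iSup₂_mono fun z r ↦ iSup₂_mono fun _ _ ↦ ?_
  gcongr
  exact h _

lemma ballMaximal_congr_ae {l : ℝ} {f g : E → ℝ≥0∞} (h : f =ᵐ[μ] g) :
    ballMaximal q μ l f = ballMaximal q μ l g := by
  ext x
  simp only [ballMaximal, lintegral_congr_ae (ae_restrict_of_ae h)]

lemma ballMaximal_add_le {l : ℝ} {f g : E → ℝ≥0∞} (hf : Measurable f) :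
    ballMaximal q μ l (f + g) ≤ ballMaximal q μ l f + ballMaximal q μ l g := by
  intro x
  refine iSup₂_le fun z r ↦ iSup₂_le fun hr hx ↦ ?_
  simp only [Pi.add_apply]
  rw [lintegral_add_left hf, ENNReal.add_div]
  exact add_le_add (le_ballMaximal hr hx) (le_ballMaximal hr hx)

lemma const_mul_ballMaximal_le {l : ℝ} {f : E → ℝ≥0∞} (a : ℝ≥0∞) (x : E) :
    a * ballMaximal q μ l f x ≤ ballMaximal q μ l (fun y ↦ a * f y) x := by
  simp only [ballMaximal, ENNReal.mul_iSup]
  refine iSup₂_mono fun z r ↦ iSup₂_mono fun _ _ ↦ ?_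
  rw [← mul_div_assoc]
  gcongr
  exact lintegral_const_mul_le _ _

variable [FiniteDimensional ℝ E] [BorelSpace E] [μ.IsAddHaarMeasure]

namespace IsBodyNorm

lemma measurableSet_closedBall (hq : IsBodyNorm q) (z : E) (r : ℝ) :
    MeasurableSet (q.closedBall z r) := (hq.isClosed z r).measurableSet

lemma measure_closedBall (z : E) {r : ℝ} (hr : 0 < r) :
    μ (q.closedBall z r) = ENNReal.ofReal (r ^ finrank ℝ E) * μ (q.closedBall 0 1) := by
  rw [q.closedBall_eq_vadd_smul z hr, measure_vadd, Measure.addHaar_smul,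
    abs_of_pos (by positivity)]

lemma measure_closedBall_ne_zero (hq : IsBodyNorm q) (z : E) {r : ℝ} (hr : 0 < r) :
    μ (q.closedBall z r) ≠ 0 := by
  refine (lt_of_lt_of_le ((hq.isOpen_ball z r).measure_pos μ ⟨z, ?_⟩)
    (measure_mono (q.ball_subset_closedBall z r))).ne'
  exact q.mem_ball_self hr

lemma measure_closedBall_ne_top (hq : IsBodyNorm q) (z : E) {r : ℝ} (hr : 0 < r) :
    μ (q.closedBall z r) ≠ ∞ := (hq.isCompact z hr).measure_ne_top

lemma lt_average_iff (hq : IsBodyNorm q) {f : E → ℝ≥0∞} {z : E} {r : ℝ} (hr : 0 < r)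
    {t : ℝ≥0∞} : t < (∫⁻ y in q.closedBall z r, f y ∂μ) / μ (q.closedBall z r) ↔
      t * μ (q.closedBall z r) < ∫⁻ y in q.closedBall z r, f y ∂μ :=
  ENNReal.lt_div_iff_mul_lt (Or.inl (hq.measure_closedBall_ne_zero z hr))
    (Or.inl (hq.measure_closedBall_ne_top z hr))

lemma le_average_iff (hq : IsBodyNorm q) {f : E → ℝ≥0∞} {z : E} {r : ℝ} (hr : 0 < r)
    {t : ℝ≥0∞} : t ≤ (∫⁻ y in q.closedBall z r, f y ∂μ) / μ (q.closedBall z r) ↔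
      t * μ (q.closedBall z r) ≤ ∫⁻ y in q.closedBall z r, f y ∂μ :=
  ENNReal.le_div_iff_mul_le (Or.inl (hq.measure_closedBall_ne_zero z hr))
    (Or.inl (hq.measure_closedBall_ne_top z hr))

/-- The explicit formula for the measure of a ball is continuous in the radius. -/
lemma continuous_const_mul_measure (hq : IsBodyNorm q) {t : ℝ≥0∞} (ht : t ≠ ∞) :
    Continuous fun r : ℝ ↦
      t * (ENNReal.ofReal (r ^ finrank ℝ E) * μ (q.closedBall 0 1)) := by
  refine (ENNReal.continuous_const_mul ht).comp ?_
  refine (ENNReal.continuous_mul_const (hq.measure_closedBall_ne_top 0 one_pos)).comp ?_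
  exact ENNReal.continuous_ofReal.comp (by fun_prop)

/-- Slightly enlarging a ball hardly changes its measure and does not decrease the integral of `f`,
so the superlevel sets of the maximal function are open. -/
lemma lowerSemicontinuous_ballMaximal (hq : IsBodyNorm q) {l : ℝ} (hl : 0 < l) (f : E → ℝ≥0∞) :
    LowerSemicontinuous (ballMaximal q μ l f) := by
  intro x t ht
  obtain ⟨z, r, hr, hx, h⟩ := lt_ballMaximal_iff.1 ht
  rw [hq.lt_average_iff hr, measure_closedBall z hr] at h
  have h1 := (hq.continuous_const_mul_measure (μ := μ) ht.ne_top).continuousAt.eventually_lt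
    (continuousAt_const (y := ∫⁻ y in q.closedBall z r, f y ∂μ)) h
  obtain ⟨r', hr', hrr'⟩ :=
    ((h1.filter_mono (nhdsWithin_le_nhds (s := Ioi r))).and self_mem_nhdsWithin).exists
  have hrr' : r < r' := hrr'
  have hx' : x ∈ q.ball z (l * r') := by
    rw [Seminorm.mem_ball]
    exact (q.mem_closedBall.1 hx).trans_lt (by gcongr)
  filter_upwards [(hq.isOpen_ball z (l * r')).mem_nhds hx'] with y hy
  have hpos := hr.trans hrr'
  refine lt_ballMaximal_iff.2 ⟨z, r', hpos, q.ball_subset_closedBall _ _ hy, ?_⟩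
  rw [hq.lt_average_iff hpos, measure_closedBall z hpos]
  exact lt_of_lt_of_le hr' (lintegral_mono_set (q.closedBall_mono hrr'.le))

lemma measurable_ballMaximal (hq : IsBodyNorm q) {l : ℝ} (hl : 0 < l) (f : E → ℝ≥0∞) :
    Measurable (ballMaximal q μ l f) := (hq.lowerSemicontinuous_ballMaximal hl f).measurable

/-- Lebesgue's differentiation theorem for the balls of `q`: these have bounded eccentricity with
respect to the norm of `E`, so they belong to a Vitali family. -/
lemma ae_exists_lt_average (hq : IsBodyNorm q) {f : E → ℝ≥0∞} (hf : Measurable f) :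
    ∀ᵐ x ∂μ, ∀ s < f x, ∃ r, 0 < r ∧
      s * μ (q.closedBall x r) < ∫⁻ y in q.closedBall x r, f y ∂μ := by
  obtain ⟨D, hDpos, hD⟩ := hq.isCompact_unitBall.isBounded.exists_pos_norm_le
  have hsub : ∀ (x : E) (r : ℝ), 0 < r → q.closedBall x r ⊆ Metric.closedBall x (D * r) := by
    intro x r hr y hy
    rw [q.closedBall_eq_vadd_smul x hr] at hy
    obtain ⟨_, ⟨u, hu, rfl⟩, rfl⟩ := hy
    rw [Metric.mem_closedBall, dist_eq_norm]
    simp only [vadd_eq_add, add_sub_cancel_left, norm_smul, Real.norm_eq_abs, abs_of_pos hr]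
    rw [mul_comm]
    gcongr
    exact hD u hu
  set d := finrank ℝ E
  set v := μ (q.closedBall 0 1)
  have hv0 : v ≠ 0 := hq.measure_closedBall_ne_zero 0 one_pos
  have hv : v ≠ ∞ := hq.measure_closedBall_ne_top 0 one_pos
  set w := μ (Metric.closedBall (0 : E) 1)
  have hw : w ≠ ∞ := (ProperSpace.isCompact_closedBall _ _).measure_ne_top
  set C₁ := ENNReal.ofReal (3 ^ d)
  set C₂ := ENNReal.ofReal ((3 * D) ^ d) * w / v
  have hC : C₁ + C₂ ≠ ∞ := by
    refine ENNReal.add_ne_top.2 ⟨ENNReal.ofReal_ne_top, ENNReal.div_ne_top ?_ hv0⟩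
    exact ENNReal.mul_ne_top ENNReal.ofReal_ne_top hw
  have hcb : ∀ (x : E) (r : ℝ), 0 < r →
      μ (Metric.closedBall x r) = ENNReal.ofReal (r ^ d) * w := fun x r hr ↦ by
    rw [Measure.addHaar_closedBall' μ x hr.le]
  have hfreq : ∀ x : E, ∃ᶠ r in 𝓝[>] (0 : ℝ), μ (Metric.closedBall x (3 * r)) ≤
      (C₁ + C₂).toNNReal * μ (Metric.closedBall x r) := by
    intro x
    refine Eventually.frequently ?_
    filter_upwards [self_mem_nhdsWithin] with r hr
    have hr : 0 < r := hr
    rw [ENNReal.coe_toNNReal hC, hcb x r hr, hcb x (3 * r) (by positivity), mul_pow,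
      ENNReal.ofReal_mul (by positivity), mul_assoc]
    gcongr
    exact le_self_add
  let V := Vitali.vitaliFamily μ (C₁ + C₂).toNNReal hfreq
  have hmem : ∀ (x : E) (r : ℝ), 0 < r → q.closedBall x r ∈ V.setsAt x := by
    intro x r hr
    refine ⟨hq.isClosed x r, ⟨x, ?_⟩, D * r, hsub x r hr, ?_⟩
    · exact mem_interior.2 ⟨_, q.ball_subset_closedBall x r, hq.isOpen_ball x r, q.mem_ball_self hr⟩
    · rw [ENNReal.coe_toNNReal hC, hcb x _ (by positivity), measure_closedBall x hr]
      calc ENNReal.ofReal ((3 * (D * r)) ^ d) * w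
          = C₂ * (ENNReal.ofReal (r ^ d) * v) := by
            rw [← mul_assoc 3, mul_pow, ENNReal.ofReal_mul (by positivity)]
            simp only [C₂, div_eq_mul_inv]
            calc _ = ENNReal.ofReal ((3 * D) ^ d) * w * ENNReal.ofReal (r ^ d) * 1 := by ring
              _ = ENNReal.ofReal ((3 * D) ^ d) * w * ENNReal.ofReal (r ^ d) * (v⁻¹ * v) := by
                rw [ENNReal.inv_mul_cancel hv0 hv]
              _ = _ := by ring
        _ ≤ _ := by gcongr; exact le_add_self
  have htend : ∀ x : E, Tendsto (fun r ↦ q.closedBall x r) (𝓝[>] 0) (V.filterAt x) := by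
    intro x
    refine V.tendsto_filterAt_iff.2 ⟨?_, fun ε hε ↦ ?_⟩
    · filter_upwards [self_mem_nhdsWithin] with r hr using hmem x r hr
    · filter_upwards [Ioo_mem_nhdsGT (show (0 : ℝ) < ε / D by positivity)] with r hr
      refine (hsub x r hr.1).trans (Metric.closedBall_subset_closedBall ?_)
      have := hr.2
      rw [lt_div_iff₀ hDpos] at this
      linarith
  -- truncations of `f`, to which the differentiation theorem for integrable functions applies
  let F : ℕ → E → ℝ≥0∞ := fun m ↦ (Metric.closedBall (0 : E) m).indicator fun x ↦ min (f x) m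
  have hFm : ∀ m, Measurable (F m) := fun m ↦
    (hf.min measurable_const).indicator Metric.isClosed_closedBall.measurableSet
  have hFle : ∀ m x, F m x ≤ f x := fun m x ↦
    (indicator_le_self' (by simp) x).trans (min_le_left _ _)
  have hFint : ∀ m, ∫⁻ x, F m x ∂μ ≠ ∞ := by
    intro m
    rw [lintegral_indicator Metric.isClosed_closedBall.measurableSet]
    refine ne_top_of_le_ne_top ?_
      (lintegral_mono (g := fun _ ↦ (m : ℝ≥0∞)) fun x ↦ min_le_right _ _)
    rw [setLIntegral_const]
    exact ENNReal.mul_ne_top (ENNReal.natCast_ne_top m)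
      (ProperSpace.isCompact_closedBall _ _).measure_ne_top
  filter_upwards [ae_all_iff.2 fun m ↦ V.ae_tendsto_lintegral_div' (hFm m) (hFint m)] with x hx s hs
  obtain ⟨m₁, hm₁⟩ := ENNReal.exists_nat_gt hs.ne_top
  obtain ⟨m₂, hm₂⟩ := exists_nat_ge ‖x‖
  have hsF : s < F (max m₁ m₂) x := by
    have hxm : x ∈ Metric.closedBall (0 : E) (max m₁ m₂ : ℕ) := by
      rw [mem_closedBall_zero_iff]
      exact hm₂.trans (by exact_mod_cast le_max_right _ _)
    simp only [F, indicator_of_mem hxm]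
    exact lt_min hs (hm₁.trans_le (by exact_mod_cast le_max_left _ _))
  obtain ⟨r, hr, hpos⟩ := ((((hx _).comp (htend x)).eventually (lt_mem_nhds hsF)).and
    self_mem_nhdsWithin).exists
  have hpos : 0 < r := hpos
  refine ⟨r, hpos, ?_⟩
  rw [Function.comp_apply, hq.lt_average_iff hpos] at hr
  exact hr.trans_le (lintegral_mono (hFle _))

lemma ae_le_ballMaximal (hq : IsBodyNorm q) {l : ℝ} (hl : 0 < l) {f : E → ℝ≥0∞}
    (hf : Measurable f) : f ≤ᵐ[μ] ballMaximal q μ l f := by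
  filter_upwards [hq.ae_exists_lt_average (μ := μ) hf] with x hx
  refine le_of_forall_lt fun s hs ↦ ?_
  obtain ⟨r, hr, h⟩ := hx s hs
  refine lt_ballMaximal_iff.2 ⟨x, r, hr, q.mem_closedBall_self (by positivity), ?_⟩
  rwa [hq.lt_average_iff hr]

end IsBodyNorm

end Measure

/-! ### The Besicovitch constant -/

/-- The covering property with overlap number `N`, stated for the balls of `q` and indexed by their
centers. -/
def OverlapBound {E : Type*} [NormedAddCommGroup E] [NormedSpace ℝ E] (q : Seminorm ℝ E) (N : ℕ) :
    Prop :=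
  ∀ (X : Set E) (r : E → ℝ) (R : ℝ), Bornology.IsBounded X → (∀ x ∈ X, 0 < r x ∧ r x ≤ R) →
    ∃ G ⊆ X, G.Countable ∧ (∀ x ∈ X, ∃ z ∈ G, x ∈ q.closedBall z (r z)) ∧
      ∀ y, {z | z ∈ G ∧ y ∈ q.closedBall z (r z)}.encard ≤ N

lemma tsum_measure_le_of_encard_le {α ι : Type*} [MeasurableSpace α] [Countable ι]
    (ν : Measure α) {A : ι → Set α} (hA : ∀ i, MeasurableSet (A i)) {N : ℕ}
    (hN : ∀ y, {i | y ∈ A i}.encard ≤ N) : ∑' i, ν (A i) ≤ N * ν (⋃ i, A i) := by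
  have h1 : ∀ y, ∑' i, (A i).indicator (fun _ ↦ (1 : ℝ≥0∞)) y ≤
      (⋃ i, A i).indicator (fun _ ↦ (N : ℝ≥0∞)) y := by
    intro y
    by_cases hy : y ∈ ⋃ i, A i
    · rw [indicator_of_mem hy]
      have h2 : ∑' i, (A i).indicator (fun _ ↦ (1 : ℝ≥0∞)) y
          = ∑' i, {i | y ∈ A i}.indicator (fun _ ↦ (1 : ℝ≥0∞)) i := by
        congr 1
      rw [h2, ← tsum_subtype, ENNReal.tsum_set_one]
      exact_mod_cast ENat.toENNReal_le.2 (hN y)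
    · have h2 : ∀ i, (A i).indicator (fun _ ↦ (1 : ℝ≥0∞)) y = 0 := fun i ↦
        indicator_of_notMem (fun h ↦ hy (mem_iUnion.2 ⟨i, h⟩)) _
      simp [h2]
  calc ∑' i, ν (A i) = ∑' i, ∫⁻ y, (A i).indicator (fun _ ↦ (1 : ℝ≥0∞)) y ∂ν := by
        congr 1; ext i; rw [lintegral_indicator_const (hA i), one_mul]
    _ = ∫⁻ y, ∑' i, (A i).indicator (fun _ ↦ (1 : ℝ≥0∞)) y ∂ν :=
        (lintegral_tsum fun i ↦ (measurable_const.indicator (hA i)).aemeasurable).symm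
    _ ≤ ∫⁻ y, (⋃ i, A i).indicator (fun _ ↦ (N : ℝ≥0∞)) y ∂ν := lintegral_mono h1
    _ = N * ν (⋃ i, A i) := lintegral_indicator_const (MeasurableSet.iUnion hA) _

section Besicovitch

variable {n : ℕ}

/-- The sets `v + r K` are the balls of the norm of `K`. -/
lemma homothets_eq {K : ConvexBody (EuclideanSpace ℝ (Fin n))}
    {q : Seminorm ℝ (EuclideanSpace ℝ (Fin n))} {c : EuclideanSpace ℝ (Fin n)}
    (hK : (K : Set (EuclideanSpace ℝ (Fin n))) = q.closedBall c 1) :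
    homothets K = {S | ∃ z r, 0 < r ∧ S = q.closedBall z r} := by
  have h : ∀ v {r : ℝ}, 0 < r → v +ᵥ r • q.closedBall c 1 = q.closedBall (v + r • c) r := by
    intro v r hr
    rw [q.closedBall_eq_vadd_smul c one_pos, one_smul, q.closedBall_eq_vadd_smul _ hr,
      add_vadd]
    congr 1
    ext y
    simp [mem_smul_set, mem_vadd_set]
  ext S
  constructor
  · rintro ⟨v, r, hr, rfl⟩
    exact ⟨v + r • c, r, hr, by rw [hK, h v hr]⟩
  · rintro ⟨z, r, hr, rfl⟩
    exact ⟨z - r • c, r, hr, by rw [hK, h _ hr, sub_add_cancel]⟩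

lemma IsSymmetricBody.exists_isBodyNorm {K : ConvexBody (EuclideanSpace ℝ (Fin n))}
    (hK : IsSymmetricBody K) : ∃ q : Seminorm ℝ (EuclideanSpace ℝ (Fin n)), IsBodyNorm q ∧
      ∃ c, (K : Set (EuclideanSpace ℝ (Fin n))) = q.closedBall c 1 := by
  obtain ⟨hint, c, hc⟩ := hK
  obtain ⟨q, hq, h⟩ := _root_.exists_isBodyNorm K.convex K.isCompact hint hc
  exact ⟨q, hq, c, h⟩

lemma maximalFn_eq_ballMaximal {K : ConvexBody (EuclideanSpace ℝ (Fin n))}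
    {q : Seminorm ℝ (EuclideanSpace ℝ (Fin n))} {c : EuclideanSpace ℝ (Fin n)} (hq : IsBodyNorm q)
    (hK : (K : Set (EuclideanSpace ℝ (Fin n))) = q.closedBall c 1) {l : ℝ} (hl : 0 < l)
    (f : EuclideanSpace ℝ (Fin n) → ℝ) :
    maximalFn K l f = ballMaximal q volume l fun x ↦ ENNReal.ofReal (f x) := by
  ext x
  refine le_antisymm ?_ ?_
  · refine iSup₂_le fun S hS ↦ iSup_le ?_
    rw [homothets_eq hK] at hS
    obtain ⟨z, r, hr, rfl⟩ := hS
    rintro ⟨c', hc', hx⟩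
    obtain rfl := hq.center_unique hr.le hc'
    rw [homothety_image_closedBall q _ _ hl] at hx
    exact le_ballMaximal hr hx
  · refine iSup₂_le fun z r ↦ iSup₂_le fun hr hx ↦ ?_
    refine le_iSup₂_of_le (q.closedBall z r) ?_ (le_iSup_of_le ?_ le_rfl)
    · rw [homothets_eq hK]
      exact ⟨z, r, hr, rfl⟩
    · refine ⟨z, center_closedBall q z r, ?_⟩
      rwa [homothety_image_closedBall q _ _ hl]

/-- On a space of positive dimension the diameter of a ball is proportional to its radius. -/
lemma IsBodyNorm.exists_diam_closedBall [NeZero n] {q : Seminorm ℝ (EuclideanSpace ℝ (Fin n))}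
    (hq : IsBodyNorm q) :
    ∃ D : ℝ, 0 < D ∧ ∀ z r, 0 < r → Metric.diam (q.closedBall z r) = r * D := by
  refine ⟨Metric.diam (q.closedBall 0 1), ?_, fun z r hr ↦ ?_⟩
  · refine Metric.diam_pos ?_ hq.isCompact_unitBall.isBounded
    have : (q.ball 0 1) ∈ 𝓝 (0 : EuclideanSpace ℝ (Fin n)) :=
      (hq.isOpen_ball 0 1).mem_nhds (q.mem_ball_self one_pos)
    have h2 : (𝓝[≠] (0 : EuclideanSpace ℝ (Fin n))).NeBot := inferInstance
    obtain ⟨y, hy, hy0⟩ := ((eventually_of_mem this fun _ h ↦ h).filter_mono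
      (nhdsWithin_le_nhds (s := {0}ᶜ))).and self_mem_nhdsWithin |>.exists
    exact ⟨y, q.ball_subset_closedBall _ _ hy, 0, q.mem_closedBall_self zero_le_one, hy0⟩
  · rw [q.closedBall_eq_vadd_smul z hr, diam_vadd, diam_smul₀, Real.norm_eq_abs,
      abs_of_pos hr]

/-- In terms of norms, the covering property defining the Besicovitch constant bounds the overlap
of balls. -/
lemma BesicovitchBound.overlapBound [NeZero n] {N : ℕ} (hN : BesicovitchBound n N)
    {q : Seminorm ℝ (EuclideanSpace ℝ (Fin n))} (hq : IsBodyNorm q) : OverlapBound q N := by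
  intro X r R hX hr
  let K : ConvexBody (EuclideanSpace ℝ (Fin n)) :=
    ⟨q.closedBall 0 1, q.convex_closedBall 0 1, hq.isCompact_unitBall,
      ⟨0, q.mem_closedBall_self zero_le_one⟩⟩
  have hK : (K : Set (EuclideanSpace ℝ (Fin n))) = q.closedBall 0 1 := rfl
  have hKs : IsSymmetricBody K := by
    refine ⟨⟨0, mem_interior.2 ⟨_, q.ball_subset_closedBall 0 1, hq.isOpen_ball 0 1,
      q.mem_ball_self one_pos⟩⟩, 0, center_closedBall q 0 1⟩
  obtain ⟨D, hD, hdiam⟩ := hq.exists_diam_closedBall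
  set F : Set (Set (EuclideanSpace ℝ (Fin n))) := (fun x ↦ q.closedBall x (r x)) '' X with hF
  have hcenters : {c | ∃ S ∈ F, IsCenter S c} = X := by
    ext c
    constructor
    · rintro ⟨_, ⟨x, hx, rfl⟩, hc⟩
      rwa [hq.center_unique (hr x hx).1.le hc]
    · intro hc
      exact ⟨_, ⟨c, hc, rfl⟩, center_closedBall q c _⟩
  have hinj : InjOn (fun x ↦ q.closedBall x (r x)) X := by
    intro x hx y hy hxy
    refine hq.center_unique (hr y hy).1.le (c := x) ?_
    have : q.closedBall x (r x) = q.closedBall y (r y) := hxy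
    rw [← this]
    exact center_closedBall q x _
  obtain ⟨G, hGF, hGc, hcov, hG⟩ := hN K hKs F (by
      rintro _ ⟨x, hx, rfl⟩
      rw [homothets_eq hK]
      exact ⟨x, r x, (hr x hx).1, rfl⟩) (by rwa [hcenters]) ⟨R * D, by
      rintro _ ⟨x, hx, rfl⟩
      rw [hdiam x _ (hr x hx).1]
      gcongr
      exact (hr x hx).2⟩
  rw [hcenters] at hcov
  refine ⟨{x | x ∈ X ∧ q.closedBall x (r x) ∈ G}, fun x hx ↦ hx.1, ?_, ?_, ?_⟩
  · refine MapsTo.countable_of_injOn (t := G) (fun x hx ↦ hx.2) (hinj.mono fun x hx ↦ hx.1) hGc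
  · intro x hx
    obtain ⟨S, hS, hxS⟩ := hcov hx
    obtain ⟨z, hz, rfl⟩ := hGF hS
    exact ⟨z, ⟨hz, hS⟩, hxS⟩
  · intro y
    refine le_trans ?_ (hG y)
    rw [← (hinj.mono (fun x hx ↦ hx.1.1)).encard_image]
    refine encard_le_encard ?_
    rintro _ ⟨z, hz, rfl⟩
    exact ⟨hz.1.2, hz.2⟩

lemma besicovitchBound_five_pow [NeZero n] : BesicovitchBound n (5 ^ n) := by
  suffices h : BesicovitchBound n (5 ^ finrank ℝ (EuclideanSpace ℝ (Fin n))) by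
    rwa [finrank_euclideanSpace_fin] at h
  intro K hK F hF _ hdiam
  obtain ⟨q, hq, c, hKq⟩ := hK.exists_isBodyNorm
  obtain ⟨R, hR⟩ := hdiam
  obtain ⟨D, hD, hdiam⟩ := hq.exists_diam_closedBall
  have hF' : ∀ S : F, ∃ z r, 0 < r ∧ (S : Set (EuclideanSpace ℝ (Fin n))) = q.closedBall z r := by
    intro S
    have := hF S.2
    rwa [homothets_eq hKq] at this
  choose z r hr hS using hF'
  obtain ⟨s, hdisj, hcount, hcov⟩ := exists_disjoint_covering_families q (fun x ↦ hq.eq_zero) z r hr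
    (R / D) (fun S ↦ by
      rw [le_div_iff₀ hD, ← hdiam (z S) _ (hr S), ← hS S]
      exact hR S S.2)
  refine ⟨Subtype.val '' ⋃ i, s i, by simp, (countable_iUnion hcount).image _, ?_, fun x ↦ ?_⟩
  · rintro c' ⟨S, hSF, hc'⟩
    rw [show S = _ from hS ⟨S, hSF⟩] at hc'
    obtain ⟨i, T, hT, h⟩ := hcov ⟨S, hSF⟩
    refine ⟨T, ⟨T, mem_iUnion.2 ⟨i, hT⟩, rfl⟩, ?_⟩
    rwa [hq.center_unique (hr _).le hc', hS T]
  · have hidx : ∀ S ∈ {S | S ∈ Subtype.val '' ⋃ i, s i ∧ x ∈ S},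
        ∃ i, ∃ T ∈ s i, (T : Set (EuclideanSpace ℝ (Fin n))) = S := by
      rintro _ ⟨⟨T, hT, rfl⟩, -⟩
      obtain ⟨i, hi⟩ := mem_iUnion.1 hT
      exact ⟨i, T, hi, rfl⟩
    choose! i hi using hidx
    refine (encard_le_encard_of_injOn (f := i) (t := univ) (fun _ _ ↦ mem_univ _) ?_).trans ?_
    · intro S hSx S' hSx' hii
      obtain ⟨T, hT, hTS⟩ := hi S hSx
      obtain ⟨T', hT', hTS'⟩ := hi S' hSx'
      rw [← hii] at hT'
      by_contra hne
      have hne' : T ≠ T' := fun h ↦ hne (by rw [← hTS, ← hTS', h])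
      have hd : Disjoint (q.closedBall (z T) (r T)) (q.closedBall (z T') (r T')) :=
        hdisj _ hT hT' hne'
      rw [← hS T, ← hS T', hTS, hTS'] at hd
      exact Set.disjoint_left.1 hd hSx.2 hSx'.2
    · simp [encard_univ]

lemma not_besicovitchBound_zero : ¬ BesicovitchBound n 0 := by
  intro h
  let q := normSeminorm ℝ (EuclideanSpace ℝ (Fin n))
  have hcl : ∀ z r, q.closedBall z r = Metric.closedBall z r := by
    intro z r; rw [closedBall_normSeminorm]
  let K : ConvexBody (EuclideanSpace ℝ (Fin n)) :=
    ⟨Metric.closedBall 0 1, convex_closedBall 0 1, isCompact_closedBall 0 1,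
      ⟨0, Metric.mem_closedBall_self zero_le_one⟩⟩
  have hc : IsCenter (Metric.closedBall (0 : EuclideanSpace ℝ (Fin n)) 1) 0 := by
    intro x hx
    simpa using hx
  have hK : IsSymmetricBody K :=
    ⟨⟨0, Metric.ball_subset_interior_closedBall (Metric.mem_ball_self one_pos)⟩, 0, hc⟩
  have hbd : Bornology.IsBounded {c | ∃ S ∈ ({(K : Set _)} : Set (Set (EuclideanSpace ℝ (Fin n)))),
      IsCenter S c} := by
    refine (Metric.isBounded_closedBall (x := 0) (r := 1)).subset ?_
    rintro c ⟨_, rfl, hc'⟩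
    have := hc' 0 (Metric.mem_closedBall_self zero_le_one)
    change c + (c - 0) ∈ Metric.closedBall (0 : EuclideanSpace ℝ (Fin n)) 1 at this
    rw [mem_closedBall_zero_iff, sub_zero, ← two_smul ℝ, norm_smul] at this
    rw [mem_closedBall_zero_iff]
    norm_num at this
    linarith [norm_nonneg c]
  obtain ⟨G, -, -, hcov, hG⟩ := h K hK {(K : Set _)} (by
    rintro _ rfl
    exact ⟨0, 1, one_pos, by simp⟩) hbd ⟨_, fun S hS ↦ by rw [hS]⟩
  obtain ⟨S, hS, h0⟩ := hcov ⟨_, rfl, hc⟩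
  have := hG 0
  rw [Nat.cast_zero, nonpos_iff_eq_zero, encard_eq_zero] at this
  exact (this ▸ (⟨hS, h0⟩ : S ∈ {S | S ∈ G ∧ (0 : EuclideanSpace ℝ (Fin n)) ∈ S}) : S ∈ (∅ : Set _))

end Besicovitch

/-! ### Level sets and coverings with bounded overlap -/

section Levels

variable {E : Type*} [NormedAddCommGroup E] [NormedSpace ℝ E] {q : Seminorm ℝ E}
  [MeasurableSpace E] {μ : Measure E} [FiniteDimensional ℝ E] [BorelSpace E] [μ.IsAddHaarMeasure]

lemma measure_le_of_forall_inter_closedBall (ν : Measure E) {A : Set E} {c : ℝ≥0∞}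
    (h : ∀ m : ℕ, ν (A ∩ Metric.closedBall 0 m) ≤ c) : ν A ≤ c := by
  have hA : A = ⋃ m : ℕ, A ∩ Metric.closedBall 0 m := by
    rw [← inter_iUnion, Metric.iUnion_closedBall_nat, inter_univ]
  have hmono : Monotone fun m : ℕ ↦ A ∩ Metric.closedBall (0 : E) m := by
    intro m m' hm
    exact inter_subset_inter_right _ (Metric.closedBall_subset_closedBall (by exact_mod_cast hm))
  rw [hA]
  exact le_of_tendsto' (tendsto_measure_iUnion_atTop hmono) h

/-- Chebyshev's inequality `s ^ (p - 1) f ≤ f ^ p` on `{f > s}`, integrated. -/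
lemma setLIntegral_lt_ne_top {α : Type*} [MeasurableSpace α] {ν : Measure α} {f : α → ℝ≥0∞} {p : ℝ}
    (hp : 1 ≤ p) (hf : ∫⁻ x, f x ^ p ∂ν ≠ ∞) (hfm : Measurable f) {s : ℝ≥0∞} (hs : s ≠ 0)
    (hs' : s ≠ ∞) : ∫⁻ x in {x | s < f x}, f x ∂ν ≠ ∞ := by
  have h1 : s ^ (p - 1) ≠ 0 := by simp [ENNReal.rpow_eq_zero_iff, hs, hs']
  have h2 : s ^ (p - 1) * ∫⁻ x in {x | s < f x}, f x ∂ν ≤ ∫⁻ x, f x ^ p ∂ν := by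
    rw [← lintegral_const_mul _ hfm]
    refine le_trans (setLIntegral_mono' (measurableSet_lt measurable_const hfm) fun x hx ↦ ?_)
      (setLIntegral_le_lintegral _ _)
    have hx : s < f x := hx
    calc s ^ (p - 1) * f x ≤ f x ^ (p - 1) * f x ^ (1 : ℝ) := by
          rw [ENNReal.rpow_one]; gcongr
      _ = f x ^ p := by
          rw [← ENNReal.rpow_add_of_nonneg _ _ (by linarith) zero_le_one, sub_add_cancel]
  intro h
  rw [h, ENNReal.mul_top h1, top_le_iff] at h2
  exact hf h2

lemma IsBodyNorm.exists_radius_bound [Nontrivial E] (hq : IsBodyNorm q) {s J : ℝ≥0∞} (hs : s ≠ 0)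
    (hJ : J ≠ ∞) : ∃ R : ℝ, ∀ z r, 0 < r → s * μ (q.closedBall z r) ≤ J → r ≤ R := by
  set v := μ (q.closedBall 0 1)
  have hv : s * v ≠ 0 := mul_ne_zero hs (hq.measure_closedBall_ne_zero 0 one_pos)
  refine ⟨max 1 (J / (s * v)).toReal, fun z r hr h ↦ ?_⟩
  rw [measure_closedBall z hr] at h
  have h1 : ENNReal.ofReal (r ^ finrank ℝ E) ≤ J / (s * v) := by
    rw [ENNReal.le_div_iff_mul_le (Or.inl hv) (Or.inr hJ)]
    calc _ = s * (ENNReal.ofReal (r ^ finrank ℝ E) * v) := by ring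
      _ ≤ J := h
  rw [ENNReal.ofReal_le_iff_le_toReal (ENNReal.div_ne_top hJ hv)] at h1
  rcases le_total r 1 with h2 | h2
  · exact h2.trans (le_max_left _ _)
  · exact (le_self_pow₀ h2 finrank_pos.ne').trans (h1.trans (le_max_right _ _))

/-- Functions in `L^p` have averages at least `t` only on balls of bounded radius. -/
lemma IsBodyNorm.exists_radius_bound_of_average [Nontrivial E] (hq : IsBodyNorm q)
    {f : E → ℝ≥0∞} {p : ℝ} (hp : 1 ≤ p) (hf : ∫⁻ x, f x ^ p ∂μ ≠ ∞) (hfm : Measurable f)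
    {t : ℝ≥0∞} (ht : t ≠ 0) (ht' : t ≠ ∞) : ∃ R : ℝ, ∀ z r, 0 < r →
      t * μ (q.closedBall z r) ≤ ∫⁻ y in q.closedBall z r, f y ∂μ → r ≤ R := by
  have hs : t / 2 ≠ 0 := by simpa using ht
  have hs' : t / 2 ≠ ∞ := ENNReal.div_ne_top ht' (by norm_num)
  obtain ⟨R, hR⟩ := hq.exists_radius_bound (μ := μ) hs (setLIntegral_lt_ne_top hp hf hfm hs hs')
  refine ⟨R, fun z r hr h ↦ hR z r hr ?_⟩
  have hB := hq.measurableSet_closedBall z r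
  have hBt := hq.measure_closedBall_ne_top (μ := μ) z hr
  have hm : MeasurableSet {x | t / 2 < f x} := measurableSet_lt measurable_const hfm
  -- split `f` into its parts below and above `t / 2`
  have h1 : ∫⁻ y in q.closedBall z r, f y ∂μ ≤
      t / 2 * μ (q.closedBall z r) + ∫⁻ x in {x | t / 2 < f x}, f x ∂μ := by
    rw [← lintegral_indicator hm, ← setLIntegral_const]
    refine le_trans ?_ (add_le_add_right (setLIntegral_le_lintegral (q.closedBall z r) _) _)
    rw [← lintegral_add_left measurable_const]
    refine lintegral_mono fun y ↦ ?_
    by_cases hy : y ∈ {x | t / 2 < f x}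
    · rw [indicator_of_mem hy]; exact le_add_self
    · rw [indicator_of_notMem hy, add_zero]
      exact not_lt.1 hy
  have h2 : t * μ (q.closedBall z r)
      = t / 2 * μ (q.closedBall z r) + t / 2 * μ (q.closedBall z r) := by
    rw [← add_mul, ENNReal.add_halves]
  rw [h2] at h
  exact (ENNReal.add_le_add_iff_left (ENNReal.mul_ne_top hs' hBt)).1 (h.trans h1)

/-- Among the balls centered at `x` over which the average of `f` is at least `t`, the largest one
has average exactly `t`. -/
lemma IsBodyNorm.exists_average_eq (hq : IsBodyNorm q) {f : E → ℝ≥0∞} {t : ℝ≥0∞} (ht : t ≠ ∞)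
    {R : ℝ} {x : E}
    (hR : ∀ r, 0 < r → t * μ (q.closedBall x r) ≤ ∫⁻ y in q.closedBall x r, f y ∂μ → r ≤ R)
    (h : ∃ r, 0 < r ∧ t * μ (q.closedBall x r) ≤ ∫⁻ y in q.closedBall x r, f y ∂μ) :
    ∃ r, 0 < r ∧ r ≤ R ∧ ∫⁻ y in q.closedBall x r, f y ∂μ = t * μ (q.closedBall x r) := by
  set A : Set ℝ := {r | 0 < r ∧ t * μ (q.closedBall x r) ≤ ∫⁻ y in q.closedBall x r, f y ∂μ} with hA
  have hbdd : BddAbove A := ⟨R, fun r hr ↦ hR r hr.1 hr.2⟩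
  obtain ⟨r₀, hr₀⟩ : A.Nonempty := h
  have hle : ∀ r ∈ A, r ≤ sSup A := fun r hr ↦ le_csSup hbdd hr
  have hpos : 0 < sSup A := hr₀.1.trans_le (hle r₀ hr₀)
  have hcont := hq.continuous_const_mul_measure (μ := μ) ht
  have hge : t * μ (q.closedBall x (sSup A)) ≤ ∫⁻ y in q.closedBall x (sSup A), f y ∂μ := by
    obtain ⟨u, -, hu, huA⟩ := exists_seq_tendsto_sSup ⟨r₀, hr₀⟩ hbdd
    rw [measure_closedBall x hpos]
    refine le_of_tendsto' ((hcont.tendsto _).comp hu) fun k ↦ ?_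
    rw [Function.comp_apply, ← measure_closedBall x (huA k).1]
    exact (huA k).2.trans (lintegral_mono_set (q.closedBall_mono (hle _ (huA k))))
  refine ⟨sSup A, hpos, hR _ hpos hge, le_antisymm ?_ hge⟩
  rw [measure_closedBall x hpos]
  refine ge_of_tendsto ((hcont.tendsto (sSup A)).mono_left
    (nhdsWithin_le_nhds (s := Ioi (sSup A)))) ?_
  filter_upwards [self_mem_nhdsWithin] with r hr
  have hr : sSup A < r := hr
  rw [← measure_closedBall x (hpos.trans hr)]
  refine (lintegral_mono_set (q.closedBall_mono hr.le)).trans (le_of_not_ge fun h' ↦ ?_)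
  exact absurd (hle r ⟨hpos.trans hr, h'⟩) (not_le.2 hr)

/-- If the average of `f` over `B` is `t`, then the excess of `f` over `t` on `B` is compensated
by its deficit on the part of `B` where `f ≤ t`. -/
lemma setLIntegral_sub_le_of_average_eq {α : Type*} [MeasurableSpace α] {ν : Measure α}
    {f : α → ℝ≥0∞} (hf : Measurable f) {B : Set α} (hν : ν B ≠ ∞) {t : ℝ≥0∞} (ht : t ≠ ∞)
    (h : ∫⁻ y in B, f y ∂ν = t * ν B) :
    ∫⁻ y in B, (f y - t) ∂ν ≤ t * ν.restrict {x | t < f x}ᶜ B := by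
  have hmin : Measurable fun y ↦ min (f y) t := hf.min measurable_const
  have hP : MeasurableSet {x | t < f x} := measurableSet_lt measurable_const hf
  have hfin : ∫⁻ y in B, min (f y) t ∂ν ≠ ∞ := by
    refine ne_top_of_le_ne_top ?_ (lintegral_mono (g := fun _ ↦ t) fun x ↦ min_le_right _ _)
    rw [setLIntegral_const]
    exact ENNReal.mul_ne_top ht hν
  have h1 : ∫⁻ y in B, (f y - t) ∂ν + ∫⁻ y in B, min (f y) t ∂ν
      = ∫⁻ y in B, (t - f y) ∂ν + ∫⁻ y in B, min (f y) t ∂ν := by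
    rw [← lintegral_add_right _ hmin, ← lintegral_add_right _ hmin]
    have e1 : ∀ y, f y - t + min (f y) t = f y := fun y ↦ by
      rcases le_total (f y) t with h | h
      · rw [min_eq_left h, tsub_eq_zero_of_le h, zero_add]
      · rw [min_eq_right h, tsub_add_cancel_of_le h]
    have e2 : ∀ y, t - f y + min (f y) t = t := fun y ↦ by
      rcases le_total (f y) t with h | h
      · rw [min_eq_left h, tsub_add_cancel_of_le h]
      · rw [min_eq_right h, tsub_eq_zero_of_le h, zero_add]
    simp only [e1, e2]
    rw [h, setLIntegral_const]
  rw [(ENNReal.add_left_inj hfin).1 h1, Measure.restrict_apply' hP.compl, inter_comm,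
    ← Measure.restrict_apply hP.compl, ← lintegral_indicator_const hP.compl]
  refine lintegral_mono fun y ↦ ?_
  by_cases hy : t < f y
  · rw [tsub_eq_zero_of_le hy.le]; exact zero_le
  · rw [indicator_of_mem (show y ∈ {x | t < f x}ᶜ from hy)]
    exact tsub_le_self

/-- Covering `{f > t}` by balls with average exactly `t`: if `U` contains all balls over which the
average of `f` is at least `t`, then the excess of `f` over `t` is controlled by the measure of
`U \ {f > t}`. The inequality is written without subtractions. -/
lemma OverlapBound.setLIntegral_add_le (hq : IsBodyNorm q) {N : ℕ} (hN : OverlapBound q N)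
    {f : E → ℝ≥0∞} (hf : Measurable f) {t : ℝ≥0∞} (ht' : t ≠ ∞) {R : ℝ}
    (hR : ∀ z r, 0 < r → t * μ (q.closedBall z r) ≤ ∫⁻ y in q.closedBall z r, f y ∂μ → r ≤ R)
    {U : Set E} (hU : ∀ z r, 0 < r →
      t * μ (q.closedBall z r) ≤ ∫⁻ y in q.closedBall z r, f y ∂μ → q.closedBall z r ⊆ U) :
    ∫⁻ x in {x | t < f x}, f x ∂μ + N * (t * μ {x | t < f x})
      ≤ t * μ {x | t < f x} + N * (t * μ U) := by
  set P : Set E := {x | t < f x} with hPdef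
  have hP : MeasurableSet P := measurableSet_lt measurable_const hf
  set L : Set E := {x | ∀ s < f x, ∃ r, 0 < r ∧
      s * μ (q.closedBall x r) < ∫⁻ y in q.closedBall x r, f y ∂μ}
  have hL : ∀ᵐ x ∂μ, x ∈ L := hq.ae_exists_lt_average hf
  have h_exact : ∀ x ∈ P ∩ L, ∃ r, 0 < r ∧ r ≤ R ∧
      ∫⁻ y in q.closedBall x r, f y ∂μ = t * μ (q.closedBall x r) := by
    rintro x ⟨hxP, hxL⟩
    obtain ⟨r, hr, h⟩ := hxL t hxP
    exact hq.exists_average_eq ht' (hR x) ⟨r, hr, h.le⟩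
  choose! r hr using h_exact
  have hPLU : P ∩ L ⊆ U := fun x hx ↦
    hU x _ (hr x hx).1 (hr x hx).2.2.ge (q.mem_closedBall_self (hr x hx).1.le)
  have hsubm : Measurable fun x ↦ f x - t := hf.sub measurable_const
  set ν := μ.withDensity fun x ↦ f x - t with hν
  have hexcess : ν P ≤ N * (t * μ (U \ P)) := by
    have hPL : ν P = ν (P ∩ L) := by
      refine measure_congr ?_
      have : ∀ᵐ x ∂ν, x ∈ L := (withDensity_absolutelyContinuous _ _) hL
      filter_upwards [this] with x hx
      exact propext ⟨fun h ↦ ⟨h, hx⟩, fun h ↦ h.1⟩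
    rw [hPL]
    refine measure_le_of_forall_inter_closedBall ν fun m ↦ ?_
    obtain ⟨G, hGX, hGc, hcov, hG⟩ := hN (P ∩ L ∩ Metric.closedBall 0 m) r R
      (Metric.isBounded_closedBall.subset inter_subset_right)
      (fun x hx ↦ ⟨(hr x hx.1).1, (hr x hx.1).2.1⟩)
    have := hGc.to_subtype
    have hG' : ∀ y, {i : G | y ∈ q.closedBall (i : E) (r i)}.encard ≤ N := by
      intro y
      rw [← Subtype.val_injective.encard_image]
      refine (encard_le_encard ?_).trans (hG y)
      rintro _ ⟨i, hi, rfl⟩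
      exact ⟨i.2, hi⟩
    calc ν (P ∩ L ∩ Metric.closedBall 0 m)
        ≤ ν (⋃ i : G, q.closedBall (i : E) (r i)) := by
          refine measure_mono fun x hx ↦ ?_
          obtain ⟨z, hz, hxz⟩ := hcov x hx
          exact mem_iUnion.2 ⟨⟨z, hz⟩, hxz⟩
      _ ≤ ∑' i : G, ν (q.closedBall (i : E) (r i)) := measure_iUnion_le _
      _ ≤ ∑' i : G, t * μ.restrict Pᶜ (q.closedBall (i : E) (r i)) := by
          refine ENNReal.tsum_le_tsum fun i ↦ ?_
          have hi := hr i (hGX i.2).1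
          rw [hν, withDensity_apply _ (hq.measurableSet_closedBall _ _)]
          exact setLIntegral_sub_le_of_average_eq hf (hq.measure_closedBall_ne_top _ hi.1) ht'
            hi.2.2
      _ = t * ∑' i : G, μ.restrict Pᶜ (q.closedBall (i : E) (r i)) := ENNReal.tsum_mul_left
      _ ≤ t * (N * μ.restrict Pᶜ (⋃ i : G, q.closedBall (i : E) (r i))) := by
          gcongr
          exact tsum_measure_le_of_encard_le _ (fun i ↦ hq.measurableSet_closedBall _ _) hG'
      _ ≤ t * (N * μ (U \ P)) := by
          have hle : μ.restrict Pᶜ (⋃ i : G, q.closedBall (i : E) (r i)) ≤ μ (U \ P) := by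
            rw [Measure.restrict_apply' hP.compl, ← sdiff_eq]
            refine measure_mono (sdiff_subset_sdiff_left (iUnion_subset fun i ↦ ?_))
            have hi := hr i (hGX i.2).1
            exact hU _ _ hi.1 hi.2.2.ge
          gcongr
      _ = N * (t * μ (U \ P)) := by ring
  have hPU : μ P ≤ μ (U ∩ P) := by
    refine measure_mono_ae ?_
    filter_upwards [hL] with x hx hxP
    exact ⟨hPLU ⟨hxP, hx⟩, hxP⟩
  have hsplit : ∫⁻ x in P, f x ∂μ ≤ ν P + t * μ P := by
    rw [hν, withDensity_apply _ hP, ← setLIntegral_const, ← lintegral_add_left hsubm]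
    exact lintegral_mono fun x ↦ le_tsub_add
  calc ∫⁻ x in P, f x ∂μ + N * (t * μ P)
      ≤ (N * (t * μ (U \ P)) + t * μ P) + N * (t * μ (U ∩ P)) := by
        gcongr
        exact hsplit.trans (by gcongr)
    _ = t * μ P + N * (t * (μ (U ∩ P) + μ (U \ P))) := by ring
    _ = t * μ P + N * (t * μ U) := by rw [measure_inter_add_sdiff U hP]

/-- The weak type (1, 1) inequality for the maximal function. -/
lemma OverlapBound.mul_measure_lt_ballMaximal_le [Nontrivial E] (hq : IsBodyNorm q) {N : ℕ}
    (hN : OverlapBound q N) {h : E → ℝ≥0∞} (hfin : ∫⁻ x, h x ∂μ ≠ ∞) {l : ℝ}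
    (hl : l ≤ 1) {s : ℝ≥0∞} (hs : s ≠ 0) :
    s * μ {x | s < ballMaximal q μ l h x} ≤ (2 ^ finrank ℝ E * N : ℕ) * ∫⁻ x, h x ∂μ := by
  set d := finrank ℝ E
  have h2 : ((2 ^ d : ℕ) : ℝ≥0∞) ≠ ∞ := ENNReal.natCast_ne_top _
  -- replace a ball whose average exceeds `s` by a concentric one around the given point
  have hcent : ∀ x ∈ {x | s < ballMaximal q μ l h x}, ∃ r, 0 < r ∧
      s * μ (q.closedBall x r) ≤ (2 ^ d : ℕ) * ∫⁻ y in q.closedBall x r, h y ∂μ := by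
    intro x hx
    obtain ⟨z, r, hr, hxz, hlt⟩ := lt_ballMaximal_iff.1 hx
    rw [hq.lt_average_iff hr] at hlt
    refine ⟨2 * r, by positivity, ?_⟩
    have hsub : q.closedBall z r ⊆ q.closedBall x (2 * r) := by
      intro y hy
      rw [Seminorm.mem_closedBall] at hy hxz ⊢
      have h1 : q (y - x) ≤ q (y - z) + q (x - z) := by
        have := map_sub_le_add q (y - z) (x - z)
        rwa [sub_sub_sub_cancel_right] at this
      nlinarith
    have hvol : μ (q.closedBall x (2 * r)) = (2 ^ d : ℕ) * μ (q.closedBall z r) := by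
      rw [IsBodyNorm.measure_closedBall x (by positivity),
        IsBodyNorm.measure_closedBall z hr, mul_pow,
        ENNReal.ofReal_mul (by positivity), mul_assoc]
      congr 1
      rw [ENNReal.ofReal_pow (by norm_num)]
      norm_num [d]
    calc s * μ (q.closedBall x (2 * r)) = (2 ^ d : ℕ) * (s * μ (q.closedBall z r)) := by
          rw [hvol]; ring
      _ ≤ (2 ^ d : ℕ) * ∫⁻ y in q.closedBall x (2 * r), h y ∂μ := by
          gcongr
          exact hlt.le.trans (lintegral_mono_set hsub)
  choose! r hr using hcent
  obtain ⟨R, hR⟩ := hq.exists_radius_bound (μ := μ) hs (ENNReal.mul_ne_top h2 hfin)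
  have hscale : ∀ A : Set E, s * μ A = (s • μ) A := fun A ↦ by simp
  rw [hscale]
  refine measure_le_of_forall_inter_closedBall _ fun m ↦ ?_
  obtain ⟨G, hGX, hGc, hcov, hG⟩ := hN
    ({x | s < ballMaximal q μ l h x} ∩ Metric.closedBall 0 m) r R
    (Metric.isBounded_closedBall.subset inter_subset_right)
    (fun x hx ↦ ⟨(hr x hx.1).1, hR x _ (hr x hx.1).1 ((hr x hx.1).2.trans
      (by gcongr; exact Measure.restrict_le_self))⟩)
  have := hGc.to_subtype
  have hG' : ∀ y, {i : G | y ∈ q.closedBall (i : E) (r i)}.encard ≤ N := by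
    intro y
    rw [← Subtype.val_injective.encard_image]
    refine (encard_le_encard ?_).trans (hG y)
    rintro _ ⟨i, hi, rfl⟩
    exact ⟨i.2, hi⟩
  calc (s • μ) ({x | s < ballMaximal q μ l h x} ∩ Metric.closedBall 0 m)
      ≤ (s • μ) (⋃ i : G, q.closedBall (i : E) (r i)) := by
        refine measure_mono fun x hx ↦ ?_
        obtain ⟨z, hz, hxz⟩ := hcov x hx
        exact mem_iUnion.2 ⟨⟨z, hz⟩, hxz⟩
    _ ≤ ∑' i : G, (s • μ) (q.closedBall (i : E) (r i)) := measure_iUnion_le _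
    _ ≤ ∑' i : G, (2 ^ d : ℕ) * μ.withDensity h (q.closedBall (i : E) (r i)) := by
        refine ENNReal.tsum_le_tsum fun i ↦ ?_
        rw [withDensity_apply _ (hq.measurableSet_closedBall _ _), ← hscale]
        exact (hr i (hGX i.2).1).2
    _ = (2 ^ d : ℕ) * ∑' i : G, μ.withDensity h (q.closedBall (i : E) (r i)) :=
        ENNReal.tsum_mul_left
    _ ≤ (2 ^ d : ℕ) * (N * μ.withDensity h (⋃ i : G, q.closedBall (i : E) (r i))) := by
        gcongr
        exact tsum_measure_le_of_encard_le _ (fun i ↦ hq.measurableSet_closedBall _ _) hG'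
    _ ≤ (2 ^ d : ℕ) * (N * ∫⁻ x, h x ∂μ) := by
        gcongr
        refine (measure_mono (subset_univ _)).trans_eq ?_
        rw [withDensity_apply _ MeasurableSet.univ, Measure.restrict_univ]
    _ = _ := by push_cast; ring

end Levels

/-! ### Layer cake formulas and integrated inequalities -/

section LayerCake

lemma setLIntegral_Ioc_rpow {s : ℝ} (hs : 0 < s) {A : ℝ} (hA : 0 ≤ A) :
    ∫⁻ t in Ioc 0 A, ENNReal.ofReal (s * t ^ (s - 1)) = ENNReal.ofReal A ^ s := by
  have hint : IntervalIntegrable (fun t : ℝ ↦ s * t ^ (s - 1)) volume 0 A :=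
    (intervalIntegral.intervalIntegrable_rpow' (by linarith)).const_mul s
  rw [← ofReal_integral_eq_lintegral_ofReal]
  · rw [← intervalIntegral.integral_of_le hA, intervalIntegral.integral_const_mul,
      integral_rpow (Or.inl (by linarith)), sub_add_cancel, Real.zero_rpow hs.ne', sub_zero,
      mul_div_cancel₀ _ hs.ne', ENNReal.ofReal_rpow_of_nonneg hA hs.le]
  · exact (intervalIntegrable_iff_integrableOn_Ioc_of_le hA).1 hint
  · filter_upwards [ae_restrict_mem measurableSet_Ioc] with t ht
    exact mul_nonneg hs.le (Real.rpow_nonneg ht.1.le _)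

lemma setLIntegral_Ioi_rpow_eq_top {s : ℝ} (hs : 0 < s) :
    ∫⁻ t in Ioi 0, ENNReal.ofReal (s * t ^ (s - 1)) = ∞ := by
  refine ENNReal.eq_top_of_forall_nnreal_le fun r ↦ ?_
  have h := setLIntegral_Ioc_rpow hs (A := (r : ℝ) ^ (1 / s)) (by positivity)
  rw [ENNReal.ofReal_rpow_of_nonneg (by positivity) hs.le, ← Real.rpow_mul (NNReal.coe_nonneg r),
    one_div_mul_cancel hs.ne', Real.rpow_one, ENNReal.ofReal_coe_nnreal] at h
  rw [← h]
  exact lintegral_mono_set Ioc_subset_Ioi_self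

/-- The pointwise layer cake formula, including the value `∞`. -/
lemma lintegral_indicator_ofReal_lt {s : ℝ} (hs : 0 < s) (a : ℝ≥0∞) :
    ∫⁻ t in Ioi (0 : ℝ), {t : ℝ | ENNReal.ofReal t < a}.indicator
      (fun t ↦ ENNReal.ofReal (s * t ^ (s - 1))) t = a ^ s := by
  have hm : MeasurableSet {t : ℝ | ENNReal.ofReal t < a} :=
    measurableSet_lt ENNReal.measurable_ofReal measurable_const
  rw [setLIntegral_indicator hm]
  rcases eq_or_ne a ∞ with rfl | ha
  · have : {t : ℝ | ENNReal.ofReal t < ∞} ∩ Ioi 0 = Ioi 0 := by ext; simp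
    rw [this, setLIntegral_Ioi_rpow_eq_top hs, ENNReal.top_rpow_of_pos hs]
  · have : {t : ℝ | ENNReal.ofReal t < a} ∩ Ioi 0 = Ioo 0 a.toReal := by
      ext t
      simp only [mem_inter_iff, mem_ofPred_eq, mem_Ioi, mem_Ioo]
      rw [and_comm]
      refine and_congr_right fun ht ↦ ?_
      rw [ENNReal.ofReal_lt_iff_lt_toReal ht.le ha]
    rw [this, setLIntegral_congr Ioo_ae_eq_Ioc,
      setLIntegral_Ioc_rpow hs ENNReal.toReal_nonneg, ENNReal.ofReal_toReal ha]

lemma lintegral_indicator_ofReal_le {s : ℝ} (hs : 0 < s) (a : ℝ≥0∞) :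
    ∫⁻ t in Ioi (0 : ℝ), {t : ℝ | ENNReal.ofReal t ≤ a}.indicator
      (fun t ↦ ENNReal.ofReal (s * t ^ (s - 1))) t = a ^ s := by
  rw [← lintegral_indicator_ofReal_lt hs a]
  refine setLIntegral_congr_fun_ae measurableSet_Ioi ?_
  have : ∀ᵐ t : ℝ, t ≠ a.toReal := by simp [ae_iff]
  filter_upwards [this] with t ht ht0
  have ht0 : 0 < t := ht0
  have hiff : ENNReal.ofReal t ≤ a ↔ ENNReal.ofReal t < a := by
    refine ⟨fun h ↦ lt_of_le_of_ne h fun h' ↦ ht ?_, le_of_lt⟩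
    rw [← h', ENNReal.toReal_ofReal ht0.le]
  simp only [indicator, mem_ofPred_eq, hiff]

variable {α : Type*} [MeasurableSpace α]

/-- The layer cake formula for functions with values in `[0, ∞]`. -/
lemma lintegral_rpow_eq_lintegral_measure_lt (ν : Measure α) [SFinite ν] {F : α → ℝ≥0∞}
    (hF : Measurable F) {s : ℝ} (hs : 0 < s) : ∫⁻ x, F x ^ s ∂ν =
      ∫⁻ t in Ioi (0 : ℝ), ENNReal.ofReal (s * t ^ (s - 1)) * ν {x | ENNReal.ofReal t < F x} := by
  simp only [← lintegral_indicator_ofReal_lt hs]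
  rw [lintegral_lintegral_swap]
  · refine lintegral_congr fun t ↦ ?_
    rw [← lintegral_indicator_const (measurableSet_lt measurable_const hF)]
    rfl
  · refine Measurable.aemeasurable ?_
    have hm : MeasurableSet {z : α × ℝ | ENNReal.ofReal z.2 < F z.1} :=
      measurableSet_lt (by fun_prop) (by fun_prop)
    exact Measurable.indicator (f := fun z : α × ℝ ↦ ENNReal.ofReal (s * z.2 ^ (s - 1)))
      (by fun_prop) hm

lemma lintegral_rpow_eq_lintegral_measure_le (ν : Measure α) [SFinite ν] {F : α → ℝ≥0∞}
    (hF : Measurable F) {s : ℝ} (hs : 0 < s) : ∫⁻ x, F x ^ s ∂ν =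
      ∫⁻ t in Ioi (0 : ℝ), ENNReal.ofReal (s * t ^ (s - 1)) * ν {x | ENNReal.ofReal t ≤ F x} := by
  simp only [← lintegral_indicator_ofReal_le hs]
  rw [lintegral_lintegral_swap]
  · refine lintegral_congr fun t ↦ ?_
    rw [← lintegral_indicator_const (measurableSet_le measurable_const hF)]
    rfl
  · refine Measurable.aemeasurable ?_
    have hm : MeasurableSet {z : α × ℝ | ENNReal.ofReal z.2 ≤ F z.1} :=
      measurableSet_le (by fun_prop) (by fun_prop)
    exact Measurable.indicator (f := fun z : α × ℝ ↦ ENNReal.ofReal (s * z.2 ^ (s - 1)))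
      (by fun_prop) hm

lemma measurable_measure_ofReal_lt (ν : Measure α) (F : α → ℝ≥0∞) :
    Measurable fun t : ℝ ↦ ν {x | ENNReal.ofReal t < F x} :=
  Antitone.measurable fun _ _ h ↦ measure_mono fun _ hx ↦ (ENNReal.ofReal_le_ofReal h).trans_lt hx

lemma measurable_measure_ofReal_le (ν : Measure α) (F : α → ℝ≥0∞) :
    Measurable fun t : ℝ ↦ ν {x | ENNReal.ofReal t ≤ F x} :=
  Antitone.measurable fun _ _ h ↦ measure_mono fun _ hx ↦ (ENNReal.ofReal_le_ofReal h).trans hx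

/-- The layer cake formula for the integrals of `f` over the superlevel sets of `F`. -/
lemma lintegral_rpow_mul_eq_lintegral_setLIntegral (ν : Measure α) [SFinite ν] {F f : α → ℝ≥0∞}
    (hF : Measurable F) (hf : Measurable f) {p : ℝ} (hp : 1 < p) :
    ENNReal.ofReal (p / (p - 1)) * ∫⁻ x, F x ^ (p - 1) * f x ∂ν =
      ∫⁻ t in Ioi (0 : ℝ), ENNReal.ofReal (p * t ^ (p - 2)) *
        ν.withDensity f {x | ENNReal.ofReal t < F x} := by
  have hp1 : 0 < p - 1 := by linarith
  have h := lintegral_rpow_eq_lintegral_measure_lt (ν.withDensity f) hF hp1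
  rw [lintegral_withDensity_eq_lintegral_mul _ hf (hF.pow_const _)] at h
  have h2 : ∫⁻ x, F x ^ (p - 1) * f x ∂ν = ∫⁻ x, (f * fun x ↦ F x ^ (p - 1)) x ∂ν :=
    lintegral_congr fun x ↦ mul_comm _ _
  rw [h2, h, ← lintegral_const_mul]
  · refine setLIntegral_congr_fun measurableSet_Ioi fun t ht ↦ ?_
    have ht : 0 < t := ht
    rw [← mul_assoc, ← ENNReal.ofReal_mul (by positivity), ← mul_assoc,
      div_mul_cancel₀ _ hp1.ne', show p - 1 - 1 = p - 2 by ring]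
  · exact Measurable.mul (by fun_prop) (measurable_measure_ofReal_lt _ _)

end LayerCake

section Norms

variable {E : Type*} [NormedAddCommGroup E] [NormedSpace ℝ E] {q : Seminorm ℝ E}
  [MeasurableSpace E] {μ : Measure E} [FiniteDimensional ℝ E] [BorelSpace E] [μ.IsAddHaarMeasure]

lemma ofReal_mul_rpow_mul_ofReal {p t : ℝ} (hp : 0 < p) (ht : 0 < t) :
    ENNReal.ofReal (p * t ^ (p - 2)) * ENNReal.ofReal t = ENNReal.ofReal (p * t ^ (p - 1)) := by
  rw [← ENNReal.ofReal_mul (by positivity), mul_assoc]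
  congr 2
  nth_rewrite 2 [← Real.rpow_one t]
  rw [← Real.rpow_add ht]
  congr 1; ring

lemma rpow_sub_one_mul_self {p : ℝ} (hp : 1 < p) (a : ℝ≥0∞) : a ^ (p - 1) * a = a ^ p := by
  nth_rewrite 2 [← ENNReal.rpow_one a]
  rw [← ENNReal.rpow_add_of_nonneg _ _ (by linarith) zero_le_one, sub_add_cancel]

/-- The lower bound for the uncentered maximal function, obtained by integrating
`OverlapBound.setLIntegral_add_le` over all levels. -/
lemma OverlapBound.mul_lintegral_rpow_le [Nontrivial E] (hq : IsBodyNorm q) {N : ℕ}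
    (hN : OverlapBound q N) {p : ℝ} (hp : 1 < p) {f : E → ℝ≥0∞} (hf : Measurable f)
    (hfin : ∫⁻ x, f x ^ p ∂μ ≠ ∞) :
    (ENNReal.ofReal (1 / (p - 1)) + N) * ∫⁻ x, f x ^ p ∂μ
      ≤ N * ∫⁻ x, ballMaximal q μ 1 f x ^ p ∂μ := by
  have hp0 : 0 < p := by linarith
  have hp1 : 0 < p - 1 := by linarith
  set g := ballMaximal q μ 1 f
  have hg : Measurable g := hq.measurable_ballMaximal one_pos f
  set w : ℝ → ℝ≥0∞ := fun t ↦ ENNReal.ofReal (p * t ^ (p - 2))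
  set w' : ℝ → ℝ≥0∞ := fun t ↦ ENNReal.ofReal (p * t ^ (p - 1))
  have hw' : Measurable w' := by fun_prop
  have hlevel : ∀ t ∈ Ioi (0 : ℝ),
      w t * μ.withDensity f {x | ENNReal.ofReal t < f x}
        + N * (w' t * μ {x | ENNReal.ofReal t < f x})
      ≤ w' t * μ {x | ENNReal.ofReal t < f x} + N * (w' t * μ {x | ENNReal.ofReal t ≤ g x}) := by
    intro t ht
    have ht : 0 < t := ht
    have ht0 : ENNReal.ofReal t ≠ 0 := by simpa using ht
    obtain ⟨R, hR⟩ := hq.exists_radius_bound_of_average hp.le hfin hf ht0 ENNReal.ofReal_ne_top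
    have h := hN.setLIntegral_add_le hq hf ENNReal.ofReal_ne_top hR
      (U := {x | ENNReal.ofReal t ≤ g x}) (fun z r hr h y hy ↦ by
        refine le_trans ?_ (le_ballMaximal hr (by rwa [one_mul]))
        rwa [hq.le_average_iff hr])
    have hmul := mul_le_mul_right h (w t)
    rw [withDensity_apply _ (measurableSet_lt measurable_const hf)]
    have hww : w' t = w t * ENNReal.ofReal t := (ofReal_mul_rpow_mul_ofReal hp0 ht).symm
    rw [hww]
    calc _ = _ := by ring
      _ ≤ _ := hmul
      _ = _ := by ring
  have hint := setLIntegral_mono' (μ := volume) measurableSet_Ioi hlevel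
  have hmf : Measurable fun t ↦ w' t * μ {x | ENNReal.ofReal t < f x} :=
    hw'.mul (measurable_measure_ofReal_lt μ f)
  have hmg : Measurable fun t ↦ w' t * μ {x | ENNReal.ofReal t ≤ g x} :=
    hw'.mul (measurable_measure_ofReal_le μ g)
  rw [lintegral_add_right _ (hmf.const_mul _), lintegral_add_left hmf,
    lintegral_const_mul _ hmf, lintegral_const_mul _ hmg,
    ← lintegral_rpow_eq_lintegral_measure_lt μ hf hp0,
    ← lintegral_rpow_eq_lintegral_measure_le μ hg hp0,
    ← lintegral_rpow_mul_eq_lintegral_setLIntegral μ hf hf hp] at hint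
  simp only [rpow_sub_one_mul_self hp] at hint
  have hsplit : ENNReal.ofReal (p / (p - 1)) = 1 + ENNReal.ofReal (1 / (p - 1)) := by
    rw [← ENNReal.ofReal_one, ← ENNReal.ofReal_add zero_le_one (by positivity)]
    congr 1; field_simp; ring
  rw [hsplit, add_mul, one_mul, add_assoc, ← add_mul] at hint
  exact (ENNReal.add_le_add_iff_left hfin).1 hint

lemma ballMaximal_const_le (hq : IsBodyNorm q) {l : ℝ} (a : ℝ≥0∞) (x : E) :
    ballMaximal q μ l (fun _ ↦ a) x ≤ a := by
  refine iSup₂_le fun z r ↦ iSup₂_le fun hr _ ↦ ?_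
  rw [setLIntegral_const, ENNReal.mul_div_cancel_right (hq.measure_closedBall_ne_zero z hr)
    (hq.measure_closedBall_ne_top z hr)]

/-- The Hardy-Littlewood maximal theorem for the balls of `q`, by interpolation between the weak
type (1, 1) inequality and the trivial bound on bounded functions. -/
lemma OverlapBound.lintegral_ballMaximal_rpow_le [Nontrivial E] (hq : IsBodyNorm q) {N : ℕ}
    (hN : OverlapBound q N) {p : ℝ} (hp : 1 < p) {l : ℝ} (hl0 : 0 < l) (hl : l ≤ 1)
    {h : E → ℝ≥0∞} (hh : Measurable h) (hfin : ∫⁻ x, h x ^ p ∂μ ≠ ∞) :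
    ∫⁻ x, ballMaximal q μ l h x ^ p ∂μ ≤
      2 * (2 ^ finrank ℝ E * N : ℕ) * ENNReal.ofReal (p / (p - 1)) * 2 ^ (p - 1) *
        ∫⁻ x, h x ^ p ∂μ := by
  have hp0 : 0 < p := by linarith
  set C : ℝ≥0∞ := ((2 ^ finrank ℝ E * N : ℕ) : ℝ≥0∞)
  set g := ballMaximal q μ l h
  have hg : Measurable g := hq.measurable_ballMaximal hl0 h
  have hlevel : ∀ t ∈ Ioi (0 : ℝ),
      ENNReal.ofReal (p * t ^ (p - 1)) * μ {x | ENNReal.ofReal t < g x} ≤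
        (2 * C) * (ENNReal.ofReal (p * t ^ (p - 2)) *
          μ.withDensity h {x | ENNReal.ofReal t < 2 * h x}) := by
    intro t ht
    have ht : 0 < t := ht
    set T := ENNReal.ofReal t
    have hT0 : T ≠ 0 := by simpa [T] using ht
    have hT : T ≠ ∞ := ENNReal.ofReal_ne_top
    have hT2 : T / 2 ≠ 0 := by simpa using hT0
    have hT2' : T / 2 ≠ ∞ := ENNReal.div_ne_top hT (by norm_num)
    have hset : {x | T / 2 < h x} = {x | T < 2 * h x} := by
      ext x
      simp only [mem_ofPred_eq]
      rw [ENNReal.div_lt_iff (Or.inl (by norm_num)) (Or.inl (by norm_num)), mul_comm]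
    have hS : MeasurableSet {x | T / 2 < h x} := measurableSet_lt measurable_const hh
    set k := {x | T / 2 < h x}.indicator h
    have hk : Measurable k := hh.indicator hS
    have hkint : ∫⁻ x, k x ∂μ = μ.withDensity h {x | T < 2 * h x} := by
      rw [lintegral_indicator hS, ← hset, withDensity_apply _ hS]
    have hkfin : ∫⁻ x, k x ∂μ ≠ ∞ := by
      rw [lintegral_indicator hS]
      exact setLIntegral_lt_ne_top hp.le hfin hh hT2 hT2'
    have hle : h ≤ k + fun _ ↦ T / 2 := by
      intro x
      by_cases hx : x ∈ {x | T / 2 < h x}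
      · simp only [k, Pi.add_apply, indicator_of_mem hx]; exact le_self_add
      · simp only [k, Pi.add_apply, indicator_of_notMem hx, zero_add]; exact not_lt.1 hx
    have hsub : {x | T < g x} ⊆ {x | T / 2 < ballMaximal q μ l k x} := by
      intro x hx
      have h1 : g x ≤ ballMaximal q μ l k x + T / 2 :=
        (ballMaximal_mono hle x).trans ((ballMaximal_add_le hk x).trans
          (add_le_add_right (ballMaximal_const_le hq _ x) _))
      by_contra h2
      have h2 : ballMaximal q μ l k x ≤ T / 2 := not_lt.1 h2
      have h3 : g x ≤ T := h1.trans ((add_le_add_left h2 _).trans (ENNReal.add_halves T).le)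
      exact absurd hx (not_lt.2 h3)
    have hweak := hN.mul_measure_lt_ballMaximal_le hq hkfin hl hT2
    rw [hkint] at hweak
    rw [← ofReal_mul_rpow_mul_ofReal hp0 ht]
    calc ENNReal.ofReal (p * t ^ (p - 2)) * T * μ {x | T < g x}
        = 2 * ENNReal.ofReal (p * t ^ (p - 2)) * (T / 2 * μ {x | T < g x}) := by
          have h2T : 2 * (T / 2) = T := ENNReal.mul_div_cancel (by norm_num) (by norm_num)
          calc _ = ENNReal.ofReal (p * t ^ (p - 2)) * (2 * (T / 2)) * μ {x | T < g x} := by rw [h2T]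
            _ = _ := by ring
      _ ≤ 2 * ENNReal.ofReal (p * t ^ (p - 2)) * (C * μ.withDensity h {x | T < 2 * h x}) := by
          exact mul_le_mul_right ((mul_le_mul_right (measure_mono hsub) _).trans hweak) _
      _ = _ := by ring
  have h2h : Measurable fun x ↦ 2 * h x := hh.const_mul 2
  rw [lintegral_rpow_eq_lintegral_measure_lt μ hg hp0]
  refine (setLIntegral_mono' measurableSet_Ioi hlevel).trans ?_
  have hm : Measurable fun t : ℝ ↦ ENNReal.ofReal (p * t ^ (p - 2)) *
      μ.withDensity h {x | ENNReal.ofReal t < 2 * h x} :=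
    Measurable.mul (by fun_prop) (measurable_measure_ofReal_lt _ _)
  rw [lintegral_const_mul _ hm, ← lintegral_rpow_mul_eq_lintegral_setLIntegral μ h2h hh hp]
  have hpt : ∀ x, (2 * h x) ^ (p - 1) * h x = 2 ^ (p - 1) * h x ^ p := by
    intro x
    rw [ENNReal.mul_rpow_of_nonneg _ _ (by linarith), mul_assoc, rpow_sub_one_mul_self hp]
  simp only [hpt]
  rw [lintegral_const_mul _ (hh.pow_const p)]
  exact le_of_eq (by ring)

end Norms

/-! ### Iterates of the almost centered maximal function -/

section Quadratic

variable {E : Type*} [NormedAddCommGroup E] [NormedSpace ℝ E] {q : Seminorm ℝ E}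
  [FiniteDimensional ℝ E]

/-- Auerbach's lemma: the coordinates with respect to a basis in the unit ball of `q` that
maximizes the determinant are bounded by `q`. -/
lemma IsBodyNorm.exists_auerbach (hq : IsBodyNorm q) :
    ∃ a : Fin (finrank ℝ E) → E →ₗ[ℝ] ℝ, (∀ i x, |a i x| ≤ q x) ∧ ∀ x, q x ≤ ∑ i, |a i x| := by
  set d := finrank ℝ E
  let b : Basis (Fin d) ℝ E := finBasis ℝ E
  set S : Set (Fin d → E) := pi univ fun _ ↦ q.closedBall 0 1
  have hS : IsCompact S := isCompact_univ_pi fun _ ↦ hq.isCompact_unitBall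
  have hcont : Continuous fun v : Fin d → E ↦ |b.det v| := by
    refine Continuous.abs ?_
    change Continuous fun v ↦ (b.toMatrix v).det
    refine Continuous.matrix_det (continuous_matrix fun i j ↦ ?_)
    exact (LinearMap.continuous_of_finiteDimensional (b.coord i)).comp (continuous_apply j)
  obtain ⟨v, hvS, hv⟩ := hS.exists_isMaxOn ⟨0, fun i _ ↦ q.mem_closedBall_self zero_le_one⟩
    hcont.continuousOn
  have hvS' : ∀ i, q (v i) ≤ 1 := fun i ↦ q.mem_closedBall_zero.1 (hvS i (mem_univ i))
  have hmax : ∀ u : Fin d → E, (∀ i, q (u i) ≤ 1) → |b.det u| ≤ |b.det v| := fun u hu ↦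
    hv fun i _ ↦ q.mem_closedBall_zero.2 (hu i)
  have hdet : b.det v ≠ 0 := by
    have hpos : ∀ i, 0 < q (b i) := fun i ↦
      lt_of_le_of_ne (apply_nonneg _ _) fun h ↦ b.ne_zero i (hq.eq_zero h.symm)
    have h1 := hmax (fun i ↦ (q (b i))⁻¹ • b i) fun i ↦ by
      rw [map_smul_eq_mul, norm_inv, Real.norm_eq_abs, abs_of_pos (hpos i),
        inv_mul_cancel₀ (hpos i).ne']
    rw [AlternatingMap.map_smul_univ, b.det_self, smul_eq_mul, mul_one] at h1
    intro h0
    rw [h0, abs_zero] at h1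
    have h2 : ∏ i, (q (b i))⁻¹ ≠ 0 := Finset.prod_ne_zero_iff.2 fun i _ ↦ (inv_pos.2 (hpos i)).ne'
    exact h2 (abs_nonpos_iff.1 h1)
  obtain ⟨hli, hsp⟩ := b.is_basis_iff_det.2 (isUnit_iff_ne_zero.2 hdet)
  let e := Basis.mk hli hsp.ge
  have hcoord : ∀ i x, b.det v * e.coord i x = b.det (Function.update v i x) := fun i x ↦
    congrArg (fun φ : E →ₗ[ℝ] ℝ ↦ φ x) (b.det_smul_mk_coord_eq_det_update hli hsp.ge i)
  have hunit : ∀ i x, q x ≤ 1 → |e.coord i x| ≤ 1 := by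
    intro i x hx
    have h1 := hmax (Function.update v i x) fun j ↦ by
      rcases eq_or_ne j i with rfl | hj
      · rwa [Function.update_self]
      · rw [Function.update_of_ne hj]; exact hvS' j
    rw [← hcoord, abs_mul] at h1
    exact le_of_mul_le_mul_left (by rwa [mul_one]) (abs_pos.2 hdet)
  refine ⟨fun i ↦ e.coord i, fun i x ↦ ?_, fun x ↦ ?_⟩
  · rcases eq_or_ne (q x) 0 with h0 | h0
    · rw [hq.eq_zero h0]; simp
    · have hpos : 0 < q x := lt_of_le_of_ne (apply_nonneg _ _) h0.symm
      have h1 := hunit i ((q x)⁻¹ • x) (by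
        rw [map_smul_eq_mul, norm_inv, Real.norm_eq_abs, abs_of_pos hpos, inv_mul_cancel₀ h0])
      rw [map_smul, smul_eq_mul, abs_mul, abs_inv, abs_of_pos hpos, inv_mul_le_iff₀ hpos,
        mul_one] at h1
      exact h1
  · calc q x = q (∑ i, e.coord i x • e i) := by
          congr 1; exact (e.sum_repr x).symm
      _ ≤ ∑ i, q (e.coord i x • e i) :=
          Finset.le_sum_of_subadditive q (map_zero q).le (map_add_le_add q) _ _
      _ ≤ ∑ i, |e.coord i x| := by
          refine Finset.sum_le_sum fun i _ ↦ ?_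
          rw [map_smul_eq_mul, Real.norm_eq_abs]
          refine mul_le_of_le_one_right (abs_nonneg _) ?_
          rw [Basis.mk_apply]
          exact hvS' i

/-- A body norm is equivalent to a Euclidean one, with a constant depending on the dimension only.
The square `Q` of the Euclidean norm is described by the properties that the barrier argument
uses. -/
lemma IsBodyNorm.exists_quadratic (hq : IsBodyNorm q) : ∃ Q : E → ℝ, Continuous Q ∧
    (∀ x y, Q (x + y) + Q (x - y) = 2 * Q x + 2 * Q y) ∧ (∀ (a : ℝ) x, Q (a • x) = a ^ 2 * Q x) ∧
    (∀ x, q x ^ 2 ≤ Q x) ∧ ∀ x, Q x ≤ (finrank ℝ E : ℝ) ^ 2 * q x ^ 2 := by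
  obtain ⟨a, ha, hqa⟩ := hq.exists_auerbach
  refine ⟨fun x ↦ finrank ℝ E * ∑ i, a i x ^ 2, ?_, ?_, ?_, ?_, ?_⟩
  · refine continuous_const.mul (continuous_finsetSum _ fun i _ ↦ Continuous.pow ?_ 2)
    exact LinearMap.continuous_of_finiteDimensional (a i)
  · intro x y
    have : ∀ i, a i (x + y) ^ 2 + a i (x - y) ^ 2 = 2 * a i x ^ 2 + 2 * a i y ^ 2 := fun i ↦ by
      rw [map_add, map_sub]; ring
    rw [← mul_add, ← Finset.sum_add_distrib, Finset.sum_congr rfl fun i _ ↦ this i,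
      Finset.sum_add_distrib, ← Finset.mul_sum, ← Finset.mul_sum]
    ring
  · intro c x
    simp only [map_smul, smul_eq_mul, mul_pow, ← Finset.mul_sum]
    ring
  · intro x
    calc q x ^ 2 ≤ (∑ i, |a i x|) ^ 2 := by gcongr; exact hqa x
      _ ≤ finrank ℝ E * ∑ i, |a i x| ^ 2 := by
          have := sq_sum_le_card_mul_sum_sq (s := Finset.univ) (f := fun i ↦ |a i x|)
          rwa [Finset.card_univ, Fintype.card_fin] at this
      _ = finrank ℝ E * ∑ i, a i x ^ 2 := by simp only [sq_abs]
  · intro x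
    calc (finrank ℝ E : ℝ) * ∑ i, a i x ^ 2
        ≤ finrank ℝ E * ∑ _i : Fin (finrank ℝ E), q x ^ 2 := by
          refine mul_le_mul_of_nonneg_left (Finset.sum_le_sum fun i _ ↦ ?_) (Nat.cast_nonneg _)
          exact sq_le_sq' (neg_le_of_abs_le (ha i x)) (le_of_abs_le (ha i x))
      _ = (finrank ℝ E : ℝ) ^ 2 * q x ^ 2 := by
          rw [Finset.sum_const, Finset.card_univ, Fintype.card_fin, nsmul_eq_mul]; ring

end Quadratic

section Iteration

variable {E : Type*} [NormedAddCommGroup E] [NormedSpace ℝ E] {q : Seminorm ℝ E}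
  [MeasurableSpace E] {μ : Measure E} [FiniteDimensional ℝ E] [BorelSpace E] [μ.IsAddHaarMeasure]

/-- The mean of a quadratic form over a ball exceeds its value at the center at most by its maximum
over the concentric ball at the origin. -/
lemma IsBodyNorm.setLIntegral_quadratic_le (hq : IsBodyNorm q) {Q : E → ℝ} (hQ : Continuous Q)
    (hpar : ∀ x y, Q (x + y) + Q (x - y) = 2 * Q x + 2 * Q y) (hQ0 : ∀ x, 0 ≤ Q x) {c z : E}
    {r m b W : ℝ} (hm : ∀ u, q u ≤ r → Q u ≤ m) (hb : 0 ≤ b) (hW : 0 < W) :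
    ∫⁻ y in q.closedBall c r, ENNReal.ofReal ((Q (y - z) + b) / W) ∂μ ≤
      ENNReal.ofReal ((Q (c - z) + m + b) / W) * μ (q.closedBall c r) := by
  set B := q.closedBall c r
  have hB : MeasurableSet B := hq.measurableSet_closedBall c r
  set F : E → ℝ≥0∞ := fun y ↦ ENNReal.ofReal ((Q (y - z) + b) / W)
  have hF : Measurable F :=
    (ENNReal.continuous_ofReal.comp (by fun_prop)).measurable
  have hrefl : ∫⁻ y in B, F (c + c - y) ∂μ = ∫⁻ y in B, F y ∂μ := by
    have hpre : (fun y ↦ c + c - y) ⁻¹' B = B := by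
      ext y
      simp only [B, mem_preimage, Seminorm.mem_closedBall]
      rw [← map_neg_eq_map q (y - c)]
      congr! 2
      abel
    have := (Measure.measurePreserving_sub_left μ (c + c)).setLIntegral_comp_preimage hB hF
    rwa [hpre] at this
  have h2 : 2 * ∫⁻ y in B, F y ∂μ ≤
      2 * (ENNReal.ofReal ((Q (c - z) + m + b) / W) * μ B) := by
    calc 2 * ∫⁻ y in B, F y ∂μ = ∫⁻ y in B, F y + F (c + c - y) ∂μ := by
          rw [lintegral_add_left hF, hrefl, two_mul]
      _ ≤ ∫⁻ _y in B, 2 * ENNReal.ofReal ((Q (c - z) + m + b) / W) ∂μ := by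
          refine setLIntegral_mono' hB fun y hy ↦ ?_
          have h1 := hpar (c - z) (y - c)
          have h3 := hm (y - c) hy
          have e1 : c - z + (y - c) = y - z := by abel
          have e2 : c - z - (y - c) = c + c - y - z := by abel
          rw [e1, e2] at h1
          have h4 := hQ0 (y - z)
          have h5 := hQ0 (c + c - y - z)
          have h6 : (2 : ℝ≥0∞) = ENNReal.ofReal 2 := by simp
          rw [← ENNReal.ofReal_add (by positivity) (by positivity), h6,
            ← ENNReal.ofReal_mul zero_le_two]
          refine ENNReal.ofReal_le_ofReal ?_
          rw [← add_div, ← mul_div_assoc]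
          gcongr
          linarith
      _ = _ := by rw [setLIntegral_const]; ring
  exact (ENNReal.mul_le_mul_iff_right (by norm_num) (by norm_num)).1 h2

lemma IsBodyNorm.one_le_ballMaximal (hq : IsBodyNorm q) {l : ℝ} (hl : 0 < l) {F : E → ℝ≥0∞}
    {O : Set E} (hO : IsOpen O) (hF : ∀ x ∈ O, 1 ≤ F x) {y : E} (hy : y ∈ O) :
    1 ≤ ballMaximal q μ l F y := by
  have hnhds : ∀ᶠ r in 𝓝[>] (0 : ℝ), q.closedBall y r ⊆ O := by
    obtain ⟨D, hD, hD'⟩ := hq.isCompact_unitBall.isBounded.exists_pos_norm_le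
    obtain ⟨ε, hε, hεO⟩ := Metric.isOpen_iff.1 hO y hy
    filter_upwards [Ioo_mem_nhdsGT (show (0 : ℝ) < ε / D by positivity)] with r hr
    refine subset_trans (fun x hx ↦ ?_) hεO
    rw [q.closedBall_eq_vadd_smul y hr.1] at hx
    obtain ⟨_, ⟨u, hu, rfl⟩, rfl⟩ := hx
    rw [Metric.mem_ball, dist_eq_norm]
    simp only [vadd_eq_add, add_sub_cancel_left, norm_smul, Real.norm_eq_abs, abs_of_pos hr.1]
    calc r * ‖u‖ ≤ r * D := by have := hr.1.le; gcongr; exact hD' u hu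
      _ < ε := (lt_div_iff₀ hD).1 hr.2
  obtain ⟨r, hrO, hr⟩ := (hnhds.and self_mem_nhdsWithin).exists
  have hr : 0 < r := hr
  refine le_trans ?_ (le_ballMaximal hr (q.mem_closedBall_self (by positivity)))
  rw [hq.le_average_iff hr, ← setLIntegral_const]
  exact setLIntegral_mono' (hq.measurableSet_closedBall y r) fun x hx ↦ hF x (hrO hx)

lemma ballMaximal_iterate_mono {l : ℝ} (k : ℕ) {f g : E → ℝ≥0∞} (h : f ≤ g) :
    (ballMaximal q μ l)^[k] f ≤ (ballMaximal q μ l)^[k] g :=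
  Monotone.iterate (fun _ _ h ↦ ballMaximal_mono h) k h

lemma IsBodyNorm.measurable_ballMaximal_iterate (hq : IsBodyNorm q) {l : ℝ} (hl : 0 < l) (k : ℕ)
    {f : E → ℝ≥0∞} (hf : Measurable f) : Measurable ((ballMaximal q μ l)^[k] f) := by
  cases k with
  | zero => exact hf
  | succ k => rw [Function.iterate_succ_apply']; exact hq.measurable_ballMaximal hl _

lemma const_mul_ballMaximal_iterate_le {l : ℝ} (k : ℕ) {f : E → ℝ≥0∞} (a : ℝ≥0∞) (x : E) :
    a * (ballMaximal q μ l)^[k] f x ≤ (ballMaximal q μ l)^[k] (fun y ↦ a * f y) x := by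
  induction k generalizing x with
  | zero => exact le_rfl
  | succ k ih =>
    rw [Function.iterate_succ_apply', Function.iterate_succ_apply']
    exact (const_mul_ballMaximal_le a x).trans (ballMaximal_mono ih x)

/-- Barrier for the iterates of the maximal function: each step raises the concave lower bound
`1 - (Q(y - z) + b) / W` by the fixed amount `γ / W`, until `b = 0`. The gain comes from averaging
over balls whose centers are moved towards `z` by a fixed fraction of the radius. -/
lemma IsBodyNorm.one_le_iterate_add (hq : IsBodyNorm q) {Q : E → ℝ} (hQ : Continuous Q)
    (hpar : ∀ x y, Q (x + y) + Q (x - y) = 2 * Q x + 2 * Q y)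
    (hhom : ∀ (a : ℝ) x, Q (a • x) = a ^ 2 * Q x) (hqQ : ∀ x, q x ^ 2 ≤ Q x) {κ : ℝ} (hκ : 1 ≤ κ)
    (hQq : ∀ x, Q x ≤ κ ^ 2 * q x ^ 2) {l : ℝ} (hl0 : 0 < l) (hl : l ≤ 1) {z : E} {τ W : ℝ}
    (hτ : 0 < τ) (hW : 0 < W) {F : E → ℝ≥0∞} (hFm : Measurable F)
    (hF : ∀ y, Q (y - z) < τ ^ 2 → 1 ≤ F y) (j : ℕ) (y : E) :
    1 ≤ (ballMaximal q μ l)^[j] F y +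
      ENNReal.ofReal ((Q (y - z) + max (W - j * (τ ^ 2 * l ^ 2 / (2 * κ ^ 2))) 0) / W) := by
  have hQ0 : ∀ x, 0 ≤ Q x := fun x ↦ (sq_nonneg _).trans (hqQ x)
  have hO : IsOpen {y | Q (y - z) < τ ^ 2} := isOpen_lt (by fun_prop) continuous_const
  have hone : ∀ j y, Q (y - z) < τ ^ 2 → 1 ≤ (ballMaximal q μ l)^[j] F y := by
    intro j
    induction j with
    | zero => exact hF
    | succ j ih =>
      intro y hy
      rw [Function.iterate_succ_apply']
      exact hq.one_le_ballMaximal hl0 hO ih hy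
  induction j generalizing y with
  | zero =>
    refine le_trans ?_ le_add_self
    rw [← ENNReal.ofReal_one]
    refine ENNReal.ofReal_le_ofReal ?_
    rw [le_div_iff₀ hW]
    have := le_max_left (W - (0 : ℕ) * (τ ^ 2 * l ^ 2 / (2 * κ ^ 2))) 0
    have := hQ0 (y - z)
    push_cast at *
    linarith
  | succ j ih =>
    rcases lt_or_ge (Q (y - z)) (τ ^ 2) with hy | hy
    · exact (hone (j + 1) y hy).trans le_self_add
    have hκ0 : 0 < κ := by linarith
    set γ := τ ^ 2 * l ^ 2 / (2 * κ ^ 2) with hγ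
    set b := max (W - j * γ) 0 with hb
    have hb0 : 0 ≤ b := le_max_right _ _
    -- the step: a ball of radius `ρ` whose center is moved towards `z` by `l * ρ`
    set s := √(Q (y - z)) with hs
    have hs2 : s ^ 2 = Q (y - z) := Real.sq_sqrt (hQ0 _)
    have hτs : τ ≤ s := Real.le_sqrt_of_sq_le hy
    have hs0 : 0 < s := hτ.trans_le hτs
    set ρ := τ * l / (2 * κ ^ 2) with hρ
    have hρ0 : 0 < ρ := by positivity
    set c := z + (1 - l * ρ / s) • (y - z) with hc
    have hQc : Q (c - z) = (s - l * ρ) ^ 2 := by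
      rw [hc, add_sub_cancel_left, hhom, ← hs2]
      field_simp
    have hyc : y ∈ q.closedBall c (l * ρ) := by
      have h1 : y - c = (l * ρ / s) • (y - z) := by
        rw [hc, sub_smul, one_smul]; abel
      have h2 : q (y - z) ≤ s := Real.le_sqrt_of_sq_le (hqQ _)
      rw [Seminorm.mem_closedBall, h1, map_smul_eq_mul, Real.norm_eq_abs,
        abs_of_pos (by positivity), div_mul_eq_mul_div, div_le_iff₀ hs0]
      gcongr
    have hm : ∀ u, q u ≤ ρ → Q u ≤ κ ^ 2 * ρ ^ 2 := fun u hu ↦ (hQq u).trans (by gcongr)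
    have hgain : Q (c - z) + κ ^ 2 * ρ ^ 2 ≤ Q (y - z) - γ := by
      have h1 : κ ^ 2 * ρ = τ * l / 2 := by rw [hρ]; field_simp
      have h2 : γ = τ * l * ρ := by rw [hγ, hρ]; field_simp
      have h3 : l ^ 2 * ρ ^ 2 ≤ κ ^ 2 * ρ ^ 2 := by gcongr; linarith
      have h4 : κ ^ 2 * ρ ^ 2 = τ * l / 2 * ρ := by rw [← h1]; ring
      have h5 : τ * (l * ρ) ≤ s * (l * ρ) := by gcongr
      rw [hQc, ← hs2, h2]
      nlinarith
    have hbb : b - γ ≤ max (W - (j + 1 : ℕ) * γ) 0 := by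
      have hγ0 : 0 ≤ γ := by positivity
      rw [hb, sub_le_iff_le_add]
      refine max_le ?_ (by positivity)
      have := le_max_left (W - (j + 1 : ℕ) * γ) 0
      push_cast at *
      linarith
    set B := q.closedBall c ρ
    have hμ0 : μ B ≠ 0 := hq.measure_closedBall_ne_zero c hρ0
    have hμ : μ B ≠ ∞ := hq.measure_closedBall_ne_top c hρ0
    have havg : μ B ≤ ∫⁻ x in B, (ballMaximal q μ l)^[j] F x ∂μ +
        ENNReal.ofReal ((Q (c - z) + κ ^ 2 * ρ ^ 2 + b) / W) * μ B := by
      calc μ B = ∫⁻ _x in B, 1 ∂μ := by rw [setLIntegral_const, one_mul]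
        _ ≤ ∫⁻ x in B, (ballMaximal q μ l)^[j] F x + ENNReal.ofReal ((Q (x - z) + b) / W) ∂μ :=
            lintegral_mono fun x ↦ ih x
        _ = ∫⁻ x in B, (ballMaximal q μ l)^[j] F x ∂μ +
              ∫⁻ x in B, ENNReal.ofReal ((Q (x - z) + b) / W) ∂μ :=
            lintegral_add_left (hq.measurable_ballMaximal_iterate hl0 j hFm) _
        _ ≤ _ := by
            gcongr
            exact hq.setLIntegral_quadratic_le hQ hpar hQ0 hm hb0 hW
    rw [Function.iterate_succ_apply']
    calc 1 = μ B / μ B := (ENNReal.div_self hμ0 hμ).symm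
      _ ≤ (∫⁻ x in B, (ballMaximal q μ l)^[j] F x ∂μ) / μ B +
          ENNReal.ofReal ((Q (c - z) + κ ^ 2 * ρ ^ 2 + b) / W) := by
          rw [← ENNReal.mul_div_cancel_right
            (a := ENNReal.ofReal ((Q (c - z) + κ ^ 2 * ρ ^ 2 + b) / W)) hμ0 hμ, ← ENNReal.add_div]
          gcongr
      _ ≤ _ := by
          gcongr ?_ + ENNReal.ofReal (?_ / W)
          · exact le_ballMaximal hρ0 hyc
          · linarith

/-- The number of steps after which the iterates of the maximal function with parameter `l` recover
the averages over whole balls up to the factor `1 - ε`, in dimension `d`. -/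
noncomputable def iterationCount (d : ℕ) (l ε : ℝ) : ℕ := ⌈2 * (d : ℝ) ^ 4 / (ε * l ^ 4)⌉₊

lemma IsBodyNorm.one_le_iterate_indicator_add [Nontrivial E] (hq : IsBodyNorm q) {l : ℝ}
    (hl0 : 0 < l) (hl : l ≤ 1) {ε : ℝ} (hε : 0 < ε) {z y : E} {r : ℝ} (hr : 0 < r)
    (hy : y ∈ q.closedBall z r) :
    1 ≤ (ballMaximal q μ l)^[iterationCount (finrank ℝ E) l ε]
      ((q.closedBall z (l * r)).indicator 1) y + ENNReal.ofReal ε := by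
  obtain ⟨Q, hQ, hpar, hhom, hqQ, hQq⟩ := hq.exists_quadratic
  set κ : ℝ := (finrank ℝ E : ℝ)
  have hκ : 1 ≤ κ := Nat.one_le_cast.2 finrank_pos
  have hκ0 : 0 < κ := by linarith
  set k := iterationCount (finrank ℝ E) l ε
  have hk : 2 * κ ^ 4 / (ε * l ^ 4) ≤ k := Nat.le_ceil _
  set W := κ ^ 2 * r ^ 2 / ε
  have hW : 0 < W := by positivity
  have h := hq.one_le_iterate_add (μ := μ) hQ hpar hhom hqQ hκ hQq hl0 hl (z := z) (τ := l * r)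
    (W := W) (by positivity) hW (F := (q.closedBall z (l * r)).indicator 1)
    (measurable_one.indicator (hq.measurableSet_closedBall _ _)) (fun x hx ↦ by
      rw [indicator_of_mem, Pi.one_apply]
      rw [Seminorm.mem_closedBall]
      exact (abs_le_of_sq_le_sq' ((hqQ _).trans hx.le) (by positivity)).2) k y
  refine h.trans (add_le_add_right (ENNReal.ofReal_le_ofReal ?_) _)
  have hsteps : W ≤ k * ((l * r) ^ 2 * l ^ 2 / (2 * κ ^ 2)) := by
    calc W = 2 * κ ^ 4 / (ε * l ^ 4) * ((l * r) ^ 2 * l ^ 2 / (2 * κ ^ 2)) := by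
          simp only [W]; field_simp
      _ ≤ _ := by gcongr
  rw [max_eq_right (by linarith), add_zero, div_le_iff₀ hW]
  calc Q (y - z) ≤ κ ^ 2 * q (y - z) ^ 2 := hQq _
    _ ≤ κ ^ 2 * r ^ 2 := by gcongr; exact hy
    _ = ε * W := by simp only [W]; field_simp

lemma IsBodyNorm.mul_ballMaximal_one_le_iterate [Nontrivial E] (hq : IsBodyNorm q) {l : ℝ}
    (hl0 : 0 < l) (hl : l ≤ 1) {ε : ℝ} (hε : 0 < ε) (f : E → ℝ≥0∞) (y : E) :
    ENNReal.ofReal (1 - ε) * ballMaximal q μ 1 f y ≤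
      (ballMaximal q μ l)^[iterationCount (finrank ℝ E) l ε + 1] f y := by
  set k := iterationCount (finrank ℝ E) l ε
  rw [ballMaximal, ENNReal.mul_iSup]
  refine iSup_le fun z ↦ ?_
  rw [ENNReal.mul_iSup]
  refine iSup_le fun r ↦ ?_
  rw [ENNReal.mul_iSup]
  refine iSup_le fun hr ↦ ?_
  rw [ENNReal.mul_iSup]
  refine iSup_le fun hy ↦ ?_
  rw [one_mul] at hy
  set a := (∫⁻ y in q.closedBall z r, f y ∂μ) / μ (q.closedBall z r)
  set I : E → ℝ≥0∞ := (q.closedBall z (l * r)).indicator 1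
  have h1 : ENNReal.ofReal (1 - ε) ≤ (ballMaximal q μ l)^[k] I y := by
    rw [ENNReal.ofReal_sub _ hε.le, ENNReal.ofReal_one, tsub_le_iff_right]
    exact hq.one_le_iterate_indicator_add hl0 hl hε hr hy
  have h2 : (fun x ↦ a * I x) ≤ ballMaximal q μ l f := by
    intro x
    by_cases hx : x ∈ q.closedBall z (l * r)
    · simp only [I, indicator_of_mem hx, Pi.one_apply, mul_one]
      exact le_ballMaximal hr hx
    · simp [I, indicator_of_notMem hx]
  calc ENNReal.ofReal (1 - ε) * a ≤ a * (ballMaximal q μ l)^[k] I y := by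
        rw [mul_comm]; gcongr
    _ ≤ (ballMaximal q μ l)^[k] (fun x ↦ a * I x) y := const_mul_ballMaximal_iterate_le k a y
    _ ≤ (ballMaximal q μ l)^[k + 1] f y := by
        rw [Function.iterate_succ_apply]
        exact ballMaximal_iterate_mono k h2 y

end Iteration

/-! ### Lower bounds in `L^p` -/

section Uniform

variable {E : Type*} [NormedAddCommGroup E] [NormedSpace ℝ E] {q : Seminorm ℝ E}
  [MeasurableSpace E] {μ : Measure E} [FiniteDimensional ℝ E] [BorelSpace E] [μ.IsAddHaarMeasure]

/-- By sublinearity, `M^(j+1) f = M^j (M f)` exceeds `M^j f` at most by `M^j (M f - f)`. -/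
lemma IsBodyNorm.iterate_succ_le_add (hq : IsBodyNorm q) {l : ℝ} (hl : 0 < l) {f : E → ℝ≥0∞}
    (hf : Measurable f) (j : ℕ) : (ballMaximal q μ l)^[j + 1] f ≤
      (ballMaximal q μ l)^[j] f + (ballMaximal q μ l)^[j] (ballMaximal q μ l f - f) := by
  induction j with
  | zero =>
    intro x
    simp only [zero_add, Function.iterate_one, Function.iterate_zero, id, Pi.add_apply,
      Pi.sub_apply]
    exact le_add_tsub
  | succ j ih =>
    simp only [Function.iterate_succ_apply' (ballMaximal q μ l)] at ih ⊢
    exact (ballMaximal_mono ih).trans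
      (ballMaximal_add_le (hq.measurable_ballMaximal_iterate hl j hf))

lemma IsBodyNorm.lintegral_iterate_rpow_le (hq : IsBodyNorm q) {l : ℝ} (hl : 0 < l) {p : ℝ}
    {C : ℝ≥0∞} (hC' : C ≠ ∞) (hC : ∀ h : E → ℝ≥0∞, Measurable h → ∫⁻ x, h x ^ p ∂μ ≠ ∞ →
      ∫⁻ x, ballMaximal q μ l h x ^ p ∂μ ≤ C * ∫⁻ x, h x ^ p ∂μ)
    {h : E → ℝ≥0∞} (hh : Measurable h) (hfin : ∫⁻ x, h x ^ p ∂μ ≠ ∞) (j : ℕ) :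
    ∫⁻ x, (ballMaximal q μ l)^[j] h x ^ p ∂μ ≤ C ^ j * ∫⁻ x, h x ^ p ∂μ := by
  induction j with
  | zero => simp
  | succ j ih =>
    rw [Function.iterate_succ_apply', pow_succ', mul_assoc]
    refine (hC _ (hq.measurable_ballMaximal_iterate hl j hh) (ne_top_of_le_ne_top ?_ ih)).trans
      (mul_le_mul_right ih C)
    exact ENNReal.mul_ne_top (ENNReal.pow_ne_top hC') hfin

/-- The norms of the iterates grow at most by a multiple of the norm of `M f - f`. -/
lemma IsBodyNorm.iterate_norm_le (hq : IsBodyNorm q) {l : ℝ} (hl : 0 < l) {p : ℝ} (hp : 1 ≤ p)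
    {C : ℝ≥0∞} (hC' : C ≠ ∞) (hC : ∀ h : E → ℝ≥0∞, Measurable h → ∫⁻ x, h x ^ p ∂μ ≠ ∞ →
      ∫⁻ x, ballMaximal q μ l h x ^ p ∂μ ≤ C * ∫⁻ x, h x ^ p ∂μ)
    {f : E → ℝ≥0∞} (hf : Measurable f)
    (hfin : ∫⁻ x, (ballMaximal q μ l f - f) x ^ p ∂μ ≠ ∞) (j : ℕ) :
    (∫⁻ x, (ballMaximal q μ l)^[j] f x ^ p ∂μ) ^ (1 / p) ≤ (∫⁻ x, f x ^ p ∂μ) ^ (1 / p) +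
      (∑ i ∈ Finset.range j, (C ^ i) ^ (1 / p)) *
        (∫⁻ x, (ballMaximal q μ l f - f) x ^ p ∂μ) ^ (1 / p) := by
  have hp0 : 0 < p := by linarith
  have hh : Measurable (ballMaximal q μ l f - f) := (hq.measurable_ballMaximal hl f).sub hf
  induction j with
  | zero => simp
  | succ j ih =>
    calc (∫⁻ x, (ballMaximal q μ l)^[j + 1] f x ^ p ∂μ) ^ (1 / p)
        ≤ (∫⁻ x, ((ballMaximal q μ l)^[j] f +
            (ballMaximal q μ l)^[j] (ballMaximal q μ l f - f)) x ^ p ∂μ) ^ (1 / p) := by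
          gcongr with x
          exact hq.iterate_succ_le_add hl hf j x
      _ ≤ (∫⁻ x, (ballMaximal q μ l)^[j] f x ^ p ∂μ) ^ (1 / p) +
          (∫⁻ x, (ballMaximal q μ l)^[j] (ballMaximal q μ l f - f) x ^ p ∂μ) ^ (1 / p) :=
          ENNReal.lintegral_Lp_add_le (hq.measurable_ballMaximal_iterate hl j hf).aemeasurable
            (hq.measurable_ballMaximal_iterate hl j hh).aemeasurable hp
      _ ≤ _ := by
          rw [Finset.sum_range_succ, add_mul, ← add_assoc,
            ← ENNReal.mul_rpow_of_nonneg _ _ (by positivity : 0 ≤ 1 / p)]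
          gcongr
          exact hq.lintegral_iterate_rpow_le hl hC' hC hh hfin j

/-- The lower bound for the uncentered maximal function in terms of the overlap number. -/
lemma OverlapBound.ofReal_mul_lintegral_rpow_le [Nontrivial E] (hq : IsBodyNorm q) {N : ℕ}
    (hN : OverlapBound q N) (hN0 : 0 < N) {p : ℝ} (hp : 1 < p) {f : E → ℝ≥0∞} (hf : Measurable f)
    (hfin : ∫⁻ x, f x ^ p ∂μ ≠ ∞) :
    ENNReal.ofReal (1 + 1 / ((p - 1) * N)) * ∫⁻ x, f x ^ p ∂μ
      ≤ ∫⁻ x, ballMaximal q μ 1 f x ^ p ∂μ := by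
  have hp1 : 0 < p - 1 := by linarith
  have hNr : (0 : ℝ) < N := by exact_mod_cast hN0
  have h := hN.mul_lintegral_rpow_le hq hp hf hfin
  have hc : ENNReal.ofReal (1 / (p - 1)) + N = N * ENNReal.ofReal (1 + 1 / ((p - 1) * N)) := by
    rw [← ENNReal.ofReal_natCast, ← ENNReal.ofReal_add (by positivity) hNr.le,
      ← ENNReal.ofReal_mul hNr.le]
    congr 1
    field_simp
    ring
  rw [hc, mul_assoc] at h
  exact (ENNReal.mul_le_mul_iff_right (by exact_mod_cast hN0.ne') (ENNReal.natCast_ne_top N)).1 h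

/-- A lower bound for the maximal function with parameter `l`, uniform over all norms satisfying the
covering property with overlap number `N`. -/
theorem exists_ofReal_mul_lintegral_rpow_le (μ : Measure E) [μ.IsAddHaarMeasure] [Nontrivial E]
    {N : ℕ} (hN0 : 0 < N) {p : ℝ} (hp : 1 < p) {l : ℝ} (hl0 : 0 < l) (hl : l ≤ 1) :
    ∃ δ : ℝ, 0 < δ ∧ ∀ q : Seminorm ℝ E, IsBodyNorm q → OverlapBound q N →
      ∀ f : E → ℝ≥0∞, Measurable f → ∫⁻ x, f x ^ p ∂μ ≠ ∞ →
        ENNReal.ofReal (1 + δ) * ∫⁻ x, f x ^ p ∂μ ≤ ∫⁻ x, ballMaximal q μ l f x ^ p ∂μ := by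
  have hp0 : 0 < p := by linarith
  have hp1 : 0 < p - 1 := by linarith
  have hNr : (0 : ℝ) < N := by exact_mod_cast hN0
  set θ : ℝ := 1 + 1 / ((p - 1) * N) with hθ
  have hθ1 : 1 < θ := by
    have : 0 < 1 / ((p - 1) * N) := by positivity
    linarith
  have hθ0 : 0 < θ := by linarith
  -- the loss `1 - ε` of the iteration is chosen so as to keep half of the exponent of `θ ^ (1 / p)`
  set β : ℝ := θ ^ (1 / (2 * p)) with hβ
  have hβ1 : 1 < β := Real.one_lt_rpow hθ1 (by positivity)
  have hβ0 : 0 < β := by linarith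
  have hε : 0 < 1 - β⁻¹ := sub_pos.2 (inv_lt_one_of_one_lt₀ hβ1)
  have hββ : β⁻¹ * θ ^ (1 / p) = β := by
    have : θ ^ (1 / p) = β * β := by
      rw [hβ, ← Real.rpow_add hθ0]
      congr 1; field_simp; ring
    rw [this, inv_mul_cancel_left₀ hβ0.ne']
  set k := iterationCount (finrank ℝ E) l (1 - β⁻¹) + 1
  set C : ℝ≥0∞ := 2 * (2 ^ finrank ℝ E * N : ℕ) * ENNReal.ofReal (p / (p - 1)) * 2 ^ (p - 1)
  have hC' : C ≠ ∞ := by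
    refine ENNReal.mul_ne_top (ENNReal.mul_ne_top (ENNReal.mul_ne_top (by norm_num)
      (ENNReal.natCast_ne_top _)) ENNReal.ofReal_ne_top) ?_
    exact ENNReal.rpow_ne_top_of_nonneg hp1.le (by norm_num)
  set D₀ : ℝ≥0∞ := ∑ i ∈ Finset.range k, (C ^ i) ^ (1 / p)
  have hD₀ : D₀ ≠ ∞ := by
    refine (ENNReal.sum_lt_top.2 fun i _ ↦ ?_).ne
    exact ENNReal.rpow_lt_top_of_nonneg (by positivity) (ENNReal.pow_ne_top hC')
  set D : ℝ := D₀.toReal + 1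
  have hD : 0 < D := by positivity
  have hD₀D : D₀ ≤ ENNReal.ofReal D := by
    rw [← ENNReal.ofReal_toReal hD₀]
    exact ENNReal.ofReal_le_ofReal (by simp [D])
  refine ⟨((β - 1) / D) ^ p, Real.rpow_pos_of_pos (div_pos (by linarith) hD) p, ?_⟩
  intro q hq hN f hf hfin
  have hHL : ∀ h : E → ℝ≥0∞, Measurable h → ∫⁻ x, h x ^ p ∂μ ≠ ∞ →
      ∫⁻ x, ballMaximal q μ l h x ^ p ∂μ ≤ C * ∫⁻ x, h x ^ p ∂μ := fun h hh hfin ↦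
    hN.lintegral_ballMaximal_rpow_le hq hp hl0 hl hh hfin
  set g := ballMaximal q μ l f
  have hg : Measurable g := hq.measurable_ballMaximal hl0 f
  set h := g - f
  have hh : Measurable h := hg.sub hf
  have hgfin : ∫⁻ x, g x ^ p ∂μ ≠ ∞ :=
    ne_top_of_le_ne_top (ENNReal.mul_ne_top hC' hfin) (hHL f hf hfin)
  have hhfin : ∫⁻ x, h x ^ p ∂μ ≠ ∞ := by
    refine ne_top_of_le_ne_top hgfin (lintegral_mono fun x ↦ ?_)
    exact ENNReal.rpow_le_rpow tsub_le_self hp0.le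
  set I := ∫⁻ x, f x ^ p ∂μ
  set J := ∫⁻ x, h x ^ p ∂μ
  have hI : I ^ (1 / p) ≠ ∞ := ENNReal.rpow_ne_top_of_nonneg (by positivity) hfin
  have hlower : ENNReal.ofReal β * I ^ (1 / p) ≤
      (∫⁻ x, (ballMaximal q μ l)^[k] f x ^ p ∂μ) ^ (1 / p) := by
    have h1 := hN.ofReal_mul_lintegral_rpow_le hq hN0 hp hf hfin
    calc ENNReal.ofReal β * I ^ (1 / p)
        = ENNReal.ofReal β⁻¹ * (ENNReal.ofReal θ * I) ^ (1 / p) := by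
          rw [ENNReal.mul_rpow_of_nonneg _ _ (by positivity),
            ENNReal.ofReal_rpow_of_nonneg hθ0.le (by positivity), ← mul_assoc,
            ← ENNReal.ofReal_mul (by positivity), hββ]
      _ ≤ ENNReal.ofReal β⁻¹ * (∫⁻ x, ballMaximal q μ 1 f x ^ p ∂μ) ^ (1 / p) := by
          gcongr
      _ = (∫⁻ x, (ENNReal.ofReal β⁻¹ * ballMaximal q μ 1 f x) ^ p ∂μ) ^ (1 / p) := by
          simp only [ENNReal.mul_rpow_of_nonneg _ _ hp0.le]
          rw [lintegral_const_mul _ ((hq.measurable_ballMaximal one_pos f).pow_const p),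
            ENNReal.mul_rpow_of_nonneg _ _ (by positivity), ← ENNReal.rpow_mul,
            mul_one_div_cancel hp0.ne', ENNReal.rpow_one]
      _ ≤ _ := by
          gcongr with x
          have := hq.mul_ballMaximal_one_le_iterate (μ := μ) hl0 hl hε f x
          rwa [sub_sub_cancel] at this
  have hupper := hq.iterate_norm_le hl0 hp.le hC' hHL hf hhfin k
  have hgap : ENNReal.ofReal (β - 1) * I ^ (1 / p) ≤ ENNReal.ofReal D * J ^ (1 / p) := by
    have h1 : I ^ (1 / p) + ENNReal.ofReal (β - 1) * I ^ (1 / p) =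
        ENNReal.ofReal β * I ^ (1 / p) := by
      nth_rewrite 1 [← one_mul (I ^ (1 / p))]
      rw [← ENNReal.ofReal_one, ← add_mul, ← ENNReal.ofReal_add zero_le_one (by linarith)]
      congr 2; ring
    refine le_trans ?_ (mul_le_mul_left hD₀D _)
    exact (ENNReal.add_le_add_iff_left hI).1 (h1.le.trans (hlower.trans hupper))
  have hJ : ENNReal.ofReal (((β - 1) / D) ^ p) * I ≤ J := by
    have h1 : ENNReal.ofReal ((β - 1) / D) * I ^ (1 / p) ≤ J ^ (1 / p) := by
      have h2 : ENNReal.ofReal (β - 1) = ENNReal.ofReal D * ENNReal.ofReal ((β - 1) / D) := by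
        rw [← ENNReal.ofReal_mul hD.le, mul_div_cancel₀ _ hD.ne']
      rw [h2, mul_assoc] at hgap
      exact (ENNReal.mul_le_mul_iff_right (by simpa using hD) ENNReal.ofReal_ne_top).1 hgap
    have h3 := ENNReal.rpow_le_rpow h1 hp0.le
    rwa [ENNReal.mul_rpow_of_nonneg _ _ hp0.le, ← ENNReal.rpow_mul, ← ENNReal.rpow_mul,
      one_div_mul_cancel hp0.ne', ENNReal.rpow_one, ENNReal.rpow_one,
      ENNReal.ofReal_rpow_of_nonneg (div_nonneg (by linarith) hD.le) hp0.le] at h3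
  rw [ENNReal.ofReal_add zero_le_one (Real.rpow_nonneg (div_nonneg (by linarith) hD.le) p),
    ENNReal.ofReal_one, add_mul, one_mul]
  calc I + ENNReal.ofReal (((β - 1) / D) ^ p) * I ≤ I + J := by gcongr
    _ = ∫⁻ x, f x ^ p + h x ^ p ∂μ := (lintegral_add_left (hf.pow_const p) _).symm
    _ ≤ ∫⁻ x, g x ^ p ∂μ := by
        refine lintegral_mono_ae ?_
        filter_upwards [hq.ae_le_ballMaximal (μ := μ) hl0 hf] with x hx
        refine (ENNReal.add_rpow_le_rpow_add _ _ hp.le).trans (ENNReal.rpow_le_rpow ?_ hp0.le)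
        exact (add_tsub_cancel_of_le hx).le

end Uniform

section Final

variable {n : ℕ} {p : ℝ}

/-- Passage from an inequality between `p`-th powers for the maximal function of a measurable
function with values in `[0, ∞]` to the `L^p` norms of a nonnegative function and of its maximal
function. -/
lemma ofReal_rpow_mul_eLpNorm_le (hp : 1 < p) {K : ConvexBody (EuclideanSpace ℝ (Fin n))}
    {q : Seminorm ℝ (EuclideanSpace ℝ (Fin n))} {c : EuclideanSpace ℝ (Fin n)} (hq : IsBodyNorm q)
    (hK : (K : Set (EuclideanSpace ℝ (Fin n))) = q.closedBall c 1) {l : ℝ} (hl : 0 < l)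
    {a : ℝ} (ha : 0 ≤ a)
    (h : ∀ f : EuclideanSpace ℝ (Fin n) → ℝ≥0∞, Measurable f → ∫⁻ x, f x ^ p ≠ ∞ →
      ENNReal.ofReal a * ∫⁻ x, f x ^ p ≤ ∫⁻ x, ballMaximal q volume l f x ^ p)
    {f : EuclideanSpace ℝ (Fin n) → ℝ} (hf : MemLp f (ENNReal.ofReal p) volume)
    (hf0 : 0 ≤ᵐ[volume] f) :
    ENNReal.ofReal (a ^ (1 / p)) * eLpNorm f (ENNReal.ofReal p) volume
      ≤ eLpNorm (maximalFn K l f) (ENNReal.ofReal p) volume := by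
  have hp0 : 0 < p := by linarith
  have hpne : ENNReal.ofReal p ≠ 0 := by simpa using hp0
  have hpr : (ENNReal.ofReal p).toReal = p := ENNReal.toReal_ofReal hp0.le
  have hFm : AEMeasurable (fun x ↦ ENNReal.ofReal (f x)) volume :=
    hf.1.aemeasurable.ennreal_ofReal
  set F := hFm.mk _
  have hF : (fun x ↦ ENNReal.ofReal (f x)) =ᵐ[volume] F := hFm.ae_eq_mk
  have hint : ∫⁻ x, ‖f x‖ₑ ^ p = ∫⁻ x, F x ^ p := by
    refine lintegral_congr_ae ?_
    filter_upwards [hF, hf0] with x hx hx0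
    rw [← hx, Real.enorm_of_nonneg hx0]
  have hfin : ∫⁻ x, F x ^ p ≠ ∞ := by
    have := lintegral_rpow_enorm_lt_top_of_eLpNorm_lt_top hpne ENNReal.ofReal_ne_top hf.2
    rw [hpr, hint] at this
    exact this.ne
  rw [maximalFn_eq_ballMaximal hq hK hl, ballMaximal_congr_ae hF,
    eLpNorm_eq_lintegral_rpow_enorm_toReal hpne ENNReal.ofReal_ne_top,
    eLpNorm_eq_lintegral_rpow_enorm_toReal hpne ENNReal.ofReal_ne_top, hpr, hint,
    ← ENNReal.ofReal_rpow_of_nonneg ha (by positivity),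
    ← ENNReal.mul_rpow_of_nonneg _ _ (by positivity)]
  simp only [enorm_eq_self]
  gcongr
  exact h F hFm.measurable_mk hfin

end Final

theorem theorem1 (n : ℕ) (hn : 1 ≤ n) (p : ℝ) (hp : 1 < p) :
    (∀ l : ℝ, 0 < l → l ≤ 1 →
      ∃ A : ℝ, 1 < A ∧
        ∀ K : ConvexBody (EuclideanSpace ℝ (Fin n)), IsSymmetricBody K →
          ∀ f : EuclideanSpace ℝ (Fin n) → ℝ, MemLp f (ENNReal.ofReal p) volume →
            0 ≤ᵐ[volume] f →
              ENNReal.ofReal A * eLpNorm f (ENNReal.ofReal p) volume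
                ≤ eLpNorm (maximalFn K l f) (ENNReal.ofReal p) volume) ∧
    0 < besicovitchConst n ∧
    BesicovitchBound n (besicovitchConst n) ∧
    ∀ K : ConvexBody (EuclideanSpace ℝ (Fin n)), IsSymmetricBody K →
      ∀ f : EuclideanSpace ℝ (Fin n) → ℝ, MemLp f (ENNReal.ofReal p) volume →
        0 ≤ᵐ[volume] f →
          ENNReal.ofReal ((1 + 1 / ((p - 1) * (besicovitchConst n : ℝ))) ^ (1 / p))
              * eLpNorm f (ENNReal.ofReal p) volume
            ≤ eLpNorm (maximalFn K 1 f) (ENNReal.ofReal p) volume := by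
  have : NeZero n := ⟨by omega⟩
  have hp0 : 0 < p := by linarith
  have hp1 : 0 < p - 1 := by linarith
  have hB : BesicovitchBound n (besicovitchConst n) :=
    Nat.sInf_mem (s := {N | BesicovitchBound n N}) ⟨_, besicovitchBound_five_pow⟩
  have hB0 : 0 < besicovitchConst n := by
    refine Nat.pos_of_ne_zero fun h0 ↦ not_besicovitchBound_zero (n := n) ?_
    rwa [h0] at hB
  refine ⟨fun l hl0 hl ↦ ?_, hB0, hB, fun K hK f hf hf0 ↦ ?_⟩
  · obtain ⟨δ, hδ, h⟩ := exists_ofReal_mul_lintegral_rpow_le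
      (volume : Measure (EuclideanSpace ℝ (Fin n))) hB0 hp hl0 hl
    refine ⟨(1 + δ) ^ (1 / p), Real.one_lt_rpow (by linarith) (by positivity), ?_⟩
    intro K hK f hf hf0
    obtain ⟨q, hq, c, hKq⟩ := hK.exists_isBodyNorm
    exact ofReal_rpow_mul_eLpNorm_le hp hq hKq hl0 (by linarith) (h q hq (hB.overlapBound hq)) hf
      hf0
  · obtain ⟨q, hq, c, hKq⟩ := hK.exists_isBodyNorm
    exact ofReal_rpow_mul_eLpNorm_le hp hq hKq one_pos (by positivity)
      (fun F hF hfin ↦ (hB.overlapBound hq).ofReal_mul_lintegral_rpow_le hq hB0 hp hF hfin) hf hf0
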